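/- For a finite set $S$ of primes and a non-zero integer $y$, let $[y]_S:=\prod_{p\in S}p^{v_p(y)}$ denote the $S$-part of $y$. Let $f\in\mathbb{Z}[X]$ be a polynomial of degree $n\ge 1$, let $\varepsilon\in(0,1/n)$, let $S$ be a finite set of primes, and let $S'\subseteq S$ be the subset of all $p\in S$ such that $f$ has a root in the ring $\mathbb{Z}_p$ of $p$-adic integers. Suppose that $f$ has no multiple root in $\mathbb{Z}_p$ for any $p\in S'$. Put $s':=\#S'$ and, for real $B>0$, $$N(f,S,\varepsilon,B):=\#\{x\in\mathbb{Z} : |x|\le B,\ 0<|f(x)|^{\varepsilon}\le [f(x)]_S\}.$$ 1. If $s'\ge 2$, then there is a constant $C(f,S,\varepsilon)>0$ such that $$N(f,S,\varepsilon,B)\sim C(f,S,\varepsilon)\cdot B^{1-n\varepsilon}(\log B)^{s'-1}\quad\text{as } B\to\infty.$$ 2. If $s'=1$, then $N(f,S,\varepsilon,B)\asymp_{f,S,\varepsilon} B^{1-n\varepsilon}$ as $B\to\infty$, but an exact asymptotic is not possible: one has $$\liminf_{B\to\infty}\frac{N(f,S,\varepsilon,B)}{B^{1-n\varepsilon}}<\limsup_{B\to\infty}\frac{N(f,S,\varepsilon,B)}{B^{1-n\varepsilon}},$$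 so that there is no constant $C$ with $N(f,S,\varepsilon,B)\sim C\cdot B^{1-n\varepsilon}$ as $B\to\infty$. -/

import Mathlib

open Filter Topology Asymptotics Polynomial

noncomputable section

instance factPrimeOfPrimes (p : Nat.Primes) : Fact (Nat.Prime (p : ℕ)) := ⟨p.2⟩

/-- The `S`-part `∏_{p ∈ S} p ^ v_p(y)` of an integer `y` (of interest for `y ≠ 0`). -/
def sPart (S : Finset Nat.Primes) (y : ℤ) : ℕ :=
  ∏ p ∈ S, (p : ℕ) ^ padicValInt (p : ℕ) y

/-- The counting function `N(f, S, ε, B)`: the number of integers `x` with `|x| ≤ B` and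
`0 < |f(x)| ^ ε ≤ [f(x)]_S`. -/
def countN (f : ℤ[X]) (S : Finset Nat.Primes) (ε B : ℝ) : ℕ :=
  Set.ncard {x : ℤ | |(x : ℝ)| ≤ B ∧ 0 < |((f.eval x : ℤ) : ℝ)| ^ ε ∧
    |((f.eval x : ℤ) : ℝ)| ^ ε ≤ (sPart S (f.eval x) : ℝ)}

/-- The image of `f` in `ℤ_p[X]`. -/
def toPadic (f : ℤ[X]) (p : Nat.Primes) : (ℤ_[(p : ℕ)])[X] :=
  f.map (Int.castRingHom ℤ_[(p : ℕ)])

open Classical in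
/-- The set `S'` of the primes `p ∈ S` such that `f` has a root in `ℤ_p`. -/
def rootPrimes (f : ℤ[X]) (S : Finset Nat.Primes) : Finset Nat.Primes :=
  S.filter fun p => ∃ α : ℤ_[(p : ℕ)], (toPadic f p).IsRoot α

end

/-! Write `n` for the degree of `f`, `a` for its leading coefficient, `ν = nε < 1` and `u =
[f(x)]_S`. For large `|x|`, `|f(x)|` is close to `|a||x|^n`, so the condition is nearly `|x| ≤ c
u^(1/ν)` with `c = |a|^(-1/n)`. Constants slightly above and below this `c` give rigorous upper and
lower bounds, and letting them tend to it costs nothing in the limit.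

For a fixed vector of exponents `e_p = v_p(f(x))`, `p ∈ S`, the integers `x` fill residue classes of
total density `∏ w_p(e_p) / p^(e_p)`. Because the roots of `f` in `ℤ_p` are simple, `w_p(e)` is
eventually constant in `e`, and that constant is positive exactly when there is a root
(`exists_isWeight_residueWeight`). Counting `|x| ≤ min(B, c u^(1/ν))` class by class costs only a
power of `log B` in error (`abs_card_levelSet_sub_le`). With `T = ν log(B/c)` the main term is `2
c^ν B^(1-ν)` times `∑ ∏ w_p(e_p) G(T - ∑ e_p log p)`, where `G(T) = min(e^T, e^(-(1/ν-1)T))`.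

This multiple sum is built one prime at a time. Summation against an eventually constant weight with
step `log p` is inverted, up to a finite sum, by the difference `U(T) - U(T - log p)`
(`shiftSum_sub_shift`). For one root prime this makes the sum asymptotically periodic and bounded. A
second root prime has an incommensurable step, so the periodic function is averaged along an
irrational rotation and the sum is asymptotic to a constant times `T`. Each further root prime
raises the power of `T` by one; primes without a root contribute finite sums. This gives the
asymptotic for `s' ≥ 2` and the order of magnitude for `s' = 1`.

For `s' = 1` with root prime `p`, the part of `f(x)` at the other primes divides a fixed `P`. Hence
`u` never lies strictly between `p^j P` and `p^j (P+1)`. While `|f(x)|^ε` is in that gap, the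
condition just says `u > p^j P`, which is periodic in `x` with a period of order `p^j`, negligible
against the window length, of order `p^(j/ν)`. So the counting function has vanishing second
differences on such windows (`exists_window`, `ncard_add_ncard_eq_two_mul`), whereas `C B^(1-ν)`
with `C > 0` is strictly concave: no limit can exist. -/

noncomputable section

/-! ### Shift sums and their difference equation -/

/-- The operator `G ↦ ∑ₑ w(e) G(T - e a)`. -/
def shiftSum (w : ℕ → ℝ) (a : ℝ) (G : ℝ → ℝ) (T : ℝ) : ℝ := ∑' e : ℕ, w e * G (T - e * a)

/-- The backward difference of a sequence, with value `w 0` at `0`. -/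
def firstDiff (w : ℕ → ℝ) : ℕ → ℝ
  | 0 => w 0
  | e + 1 => w (e + 1) - w e

theorem sum_range_firstDiff (w : ℕ → ℝ) (N : ℕ) :
    ∑ e ∈ Finset.range (N + 1), firstDiff w e = w N := by
  induction N with
  | zero => simp [firstDiff]
  | succ k ih => rw [Finset.sum_range_succ, ih]; simp [firstDiff]

theorem exists_bound_of_eventually_const {w : ℕ → ℝ} {c : ℝ} (h : ∀ᶠ e in atTop, w e = c) :
    ∃ D, 0 < D ∧ ∀ e, |w e| ≤ D := by
  have : Tendsto w atTop (𝓝 c) := tendsto_const_nhds.congr' (h.mono fun _ h => h.symm)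
  obtain ⟨D, hD⟩ := (Metric.isBounded_range_of_tendsto w this).exists_norm_le
  exact ⟨|D| + 1, by positivity, fun e => (hD _ ⟨e, rfl⟩).trans ((le_abs_self D).trans (by linarith))⟩

theorem summable_exp_neg_mul {a : ℝ} (ha : 0 < a) : Summable fun e : ℕ => Real.exp (-(e * a)) := by
  have : (fun e : ℕ => Real.exp (-(e * a))) = fun e : ℕ => (Real.exp (-a)) ^ e := by
    ext e; rw [← Real.exp_nat_mul]; ring_nf
  rw [this]
  exact summable_geometric_of_lt_one (Real.exp_nonneg _) (by simpa using ha)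

section

variable {w : ℕ → ℝ} {a D A : ℝ} {G : ℝ → ℝ}

theorem abs_shiftSum_term_le (hD : 0 ≤ D) (hw : ∀ e, |w e| ≤ D)
    (hG : ∀ T, |G T| ≤ A * Real.exp T) (T : ℝ) (e : ℕ) :
    |w e * G (T - e * a)| ≤ D * A * Real.exp T * Real.exp (-(e * a)) := by
  rw [abs_mul]
  calc |w e| * |G (T - e * a)| ≤ D * (A * Real.exp (T - e * a)) :=
        mul_le_mul (hw e) (hG _) (abs_nonneg _) hD
    _ = _ := by rw [sub_eq_add_neg, Real.exp_add]; ring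

theorem summable_shiftSum (ha : 0 < a) (hD : 0 ≤ D) (hw : ∀ e, |w e| ≤ D)
    (hG : ∀ T, |G T| ≤ A * Real.exp T) (T : ℝ) : Summable fun e : ℕ => w e * G (T - e * a) :=
  Summable.of_norm_bounded ((summable_exp_neg_mul ha).mul_left (D * A * Real.exp T))
    (abs_shiftSum_term_le hD hw hG T)

theorem abs_shiftSum_le (ha : 0 < a) (hD : 0 ≤ D) (hw : ∀ e, |w e| ≤ D)
    (hG : ∀ T, |G T| ≤ A * Real.exp T) (T : ℝ) :
    |shiftSum w a G T| ≤ D * A * (∑' e : ℕ, Real.exp (-(e * a))) * Real.exp T := by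
  have := tsum_of_norm_bounded (f := fun e : ℕ => w e * G (T - e * a)) ((summable_exp_neg_mul ha).mul_left (D * A * Real.exp T)).hasSum
    (abs_shiftSum_term_le hD hw hG T)
  rw [tsum_mul_left] at this
  rw [shiftSum, ← Real.norm_eq_abs]
  linarith

theorem continuous_shiftSum (ha : 0 < a) (hD : 0 ≤ D) (hw : ∀ e, |w e| ≤ D)
    (hG : ∀ T, |G T| ≤ A * Real.exp T) (hc : Continuous G) : Continuous (shiftSum w a G) := by
  -- The factor `e^(-T)` makes the majorant of the terms independent of `T`, so that the series
  -- converges uniformly.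
  have h1 : Continuous fun T => ∑' e : ℕ, w e * G (T - e * a) * Real.exp (-T) := by
    refine continuous_tsum (u := fun e : ℕ => D * A * Real.exp (-(e * a))) (fun e => by fun_prop)
      ((summable_exp_neg_mul ha).mul_left _) fun e T => ?_
    rw [norm_mul, Real.norm_of_nonneg (Real.exp_nonneg _)]
    have := mul_le_mul_of_nonneg_right (abs_shiftSum_term_le (a := a) hD hw hG T e)
      (Real.exp_nonneg (-T))
    refine this.trans (le_of_eq ?_)
    have h : Real.exp T * Real.exp (-T) = 1 := by rw [← Real.exp_add]; simp
    linear_combination (D * A * Real.exp (-(e * a))) * h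
  have h2 : shiftSum w a G = fun T => (∑' e : ℕ, w e * G (T - e * a) * Real.exp (-T)) * Real.exp T := by
    ext T
    rw [tsum_mul_right, mul_assoc, ← Real.exp_add]; simp [shiftSum]
  rw [h2]
  exact h1.mul Real.continuous_exp

theorem shiftSum_nonneg (hw : ∀ e, 0 ≤ w e) (hG : ∀ T, 0 ≤ G T) (T : ℝ) : 0 ≤ shiftSum w a G T :=
  tsum_nonneg fun e => mul_nonneg (hw e) (hG _)

theorem shiftSum_eq_sum {N : ℕ} (hw : ∀ e, N ≤ e → w e = 0) (T : ℝ) :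
    shiftSum w a G T = ∑ e ∈ Finset.range N, w e * G (T - e * a) :=
  tsum_eq_sum fun e he => by rw [hw e (by simpa using he), zero_mul]

/-- Abel summation. Its use: for an eventually constant weight, `firstDiff w` has finite support and
total mass equal to the final value of `w`, so the infinite sum solves a difference equation with an
explicit finite right-hand side. -/
theorem shiftSum_sub_shift (ha : 0 < a) (hD : 0 ≤ D) (hw : ∀ e, |w e| ≤ D)
    (hG : ∀ T, |G T| ≤ A * Real.exp T) (T : ℝ) :
    shiftSum w a G T - shiftSum w a G (T - a) = shiftSum (firstDiff w) a G T := by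
  have h1 := summable_shiftSum ha hD hw hG T
  have h2 := summable_shiftSum ha hD hw hG (T - a)
  have h3 : Summable fun e : ℕ => firstDiff w e * G (T - e * a) := by
    rw [← summable_nat_add_iff 1]
    refine (((summable_nat_add_iff 1).2 h1).sub h2).congr fun e => ?_
    simp only [firstDiff]; push_cast; ring_nf
  rw [shiftSum, shiftSum, shiftSum, h1.tsum_eq_zero_add, h3.tsum_eq_zero_add, add_sub_assoc,
    ← ((summable_nat_add_iff 1).2 h1).tsum_sub h2]
  congr 1
  refine tsum_congr fun e => ?_
  simp only [firstDiff]; push_cast; ring_nf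

theorem tendsto_sub_const_div_atTop (b : ℝ) : Tendsto (fun T : ℝ => (T - b) / T) atTop (𝓝 1) := by
  have h : Tendsto (fun T : ℝ => 1 - b / T) atTop (𝓝 (1 - 0)) :=
    tendsto_const_nhds.sub (tendsto_const_nhds.div_atTop tendsto_id)
  rw [sub_zero] at h
  refine h.congr' ?_
  filter_upwards [eventually_gt_atTop 0] with T hT
  field_simp

/-- A finitely supported `shiftSum` preserves asymptotics of polynomial type. -/
theorem tendsto_shiftSum_of_finite {N d : ℕ} {C : ℝ} (hw : ∀ e, N ≤ e → w e = 0)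
    (hG : Tendsto (fun T => G T / T ^ d) atTop (𝓝 C)) :
    Tendsto (fun T => shiftSum w a G T / T ^ d) atTop
      (𝓝 ((∑ e ∈ Finset.range N, w e) * C)) := by
  have key : ∀ e ∈ Finset.range N,
      Tendsto (fun T => w e * G (T - e * a) / T ^ d) atTop (𝓝 (w e * C)) := by
    intro e _
    have h1 : Tendsto (fun T : ℝ => T - e * a) atTop atTop :=
      tendsto_atTop_add_const_right _ _ tendsto_id
    have h2 := (hG.comp h1).mul ((tendsto_sub_const_div_atTop (e * a)).pow d)
    rw [one_pow, mul_one] at h2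
    refine (h2.const_mul (w e)).congr' ?_
    filter_upwards [eventually_gt_atTop 0, eventually_gt_atTop (e * a)] with T hT hT'
    have : T - e * a ≠ 0 := by linarith
    simp only [Function.comp]
    rw [div_pow]; field_simp
  rw [Finset.sum_mul]
  refine (tendsto_finsetSum _ key).congr fun T => ?_
  rw [shiftSum_eq_sum hw, Finset.sum_div]

end

/-! ### Growth of a function from its steps -/

section

variable {E : Type*} [SeminormedAddCommGroup E] {V : ℝ → E} {a : ℝ}

/-- Walking back from `T` in steps of length `a` reaches the strip `[T₁ - a, T₁]` after at most `T /
a + 1` steps, each costing at most `δ * T ^ d`. -/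
theorem norm_le_of_step_le {A δ T₁ : ℝ} {d : ℕ} (ha : 0 < a) (hT₁ : 0 ≤ T₁) (hδ : 0 ≤ δ)
    (h0 : ∀ T ∈ Set.Icc (T₁ - a) T₁, ‖V T‖ ≤ A)
    (h : ∀ T, T₁ ≤ T → ‖V T - V (T - a)‖ ≤ δ * T ^ d) (T : ℝ) (hT : T₁ ≤ T) :
    ‖V T‖ ≤ A + δ * T ^ d * (T / a + 1) := by
  have key : ∀ k : ℕ, ∀ T, T₁ ≤ T → T < T₁ + k * a → ‖V T‖ ≤ A + δ * T ^ d * k := by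
    intro k
    induction k with
    | zero => intro T h1 h2; simp at h2; linarith
    | succ k ih =>
      intro T h1 h2
      push_cast at h2 ⊢
      have hpow : 0 ≤ T ^ d := pow_nonneg (hT₁.trans h1) _
      have h3 : ‖V T‖ ≤ ‖V (T - a)‖ + δ * T ^ d := by
        have := norm_le_norm_add_norm_sub' (V T) (V (T - a))
        linarith [h T h1]
      by_cases h4 : T₁ ≤ T - a
      · have h5 := ih (T - a) h4 (by linarith)
        have h6 : (T - a) ^ d ≤ T ^ d := pow_le_pow_left₀ (hT₁.trans h4) (by linarith) _
        have h7 : δ * (T - a) ^ d * k ≤ δ * T ^ d * k := by gcongr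
        nlinarith
      · have h5 := h0 (T - a) ⟨by linarith, by linarith⟩
        have : 0 ≤ δ * T ^ d * k := by positivity
        nlinarith
  have hq : 0 ≤ (T - T₁) / a := div_nonneg (by linarith) ha.le
  have h1 := key (⌊(T - T₁) / a⌋₊ + 1) T hT (by
    have := Nat.lt_floor_add_one ((T - T₁) / a)
    rw [div_lt_iff₀ ha] at this
    push_cast; linarith)
  refine h1.trans ?_
  have h2 := Nat.floor_le hq
  have h3 : (T - T₁) / a ≤ T / a := by gcongr; linarith
  have hpow : 0 ≤ T ^ d := pow_nonneg (hT₁.trans hT) _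
  push_cast
  gcongr
  linarith

theorem eventually_norm_le_of_step_le {δ : ℝ} {d : ℕ} (ha : 0 < a) (hδ : 0 < δ)
    (hb : ∀ R : ℝ, ∃ A, ∀ T, |T| ≤ R → ‖V T‖ ≤ A)
    (h : ∀ᶠ T in atTop, ‖V T - V (T - a)‖ ≤ δ * T ^ d) :
    ∀ᶠ T in atTop, ‖V T‖ ≤ 2 * δ / a * T ^ (d + 1) := by
  obtain ⟨T₀, hT₀⟩ := eventually_atTop.1 h
  set T₁ := max T₀ a
  have hT₁ : a ≤ T₁ := le_max_right _ _
  obtain ⟨A, hA⟩ := hb T₁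
  have key := norm_le_of_step_le (V := V) (A := A) (d := d) ha (ha.le.trans hT₁) hδ.le
    (fun T hT => hA T (abs_le.2 ⟨by linarith [hT.1], hT.2⟩))
    (fun T hT => hT₀ T ((le_max_left _ _).trans hT))
  have h1 : Tendsto (fun T : ℝ => δ / a * T) atTop atTop := tendsto_id.const_mul_atTop (by positivity)
  filter_upwards [eventually_ge_atTop T₁, h1.eventually_ge_atTop (|A| + δ),
    eventually_ge_atTop 1] with T hT h2 h3
  refine (key T hT).trans ?_
  have hp : 1 ≤ T ^ d := one_le_pow₀ h3
  have h4 : A ≤ |A| * T ^ d := (le_abs_self A).trans (le_mul_of_one_le_right (abs_nonneg _) hp)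
  have h5 : (|A| + δ) * T ^ d ≤ δ / a * T * T ^ d := by gcongr
  have h6 : 2 * δ / a * T ^ (d + 1) = δ / a * T * T ^ d + δ * T ^ d * (T / a) := by
    rw [pow_succ]; field_simp; ring
  rw [h6]
  linarith

theorem tendsto_pow_succ_step (a : ℝ) (d : ℕ) :
    Tendsto (fun T : ℝ => (T ^ (d + 1) - (T - a) ^ (d + 1)) / T ^ d) atTop (𝓝 ((d + 1) * a)) := by
  have h : Tendsto (fun T : ℝ => (∑ i ∈ Finset.range (d + 1), ((T - a) / T) ^ (d - i)) * a) atTop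
      (𝓝 ((∑ i ∈ Finset.range (d + 1), 1 ^ (d - i)) * a)) :=
    (tendsto_finsetSum _ fun i _ => (tendsto_sub_const_div_atTop a).pow _).mul_const a
  simp only [one_pow, Finset.sum_const, Finset.card_range, nsmul_eq_mul, mul_one, Nat.cast_add,
    Nat.cast_one] at h
  refine h.congr' ?_
  filter_upwards [eventually_gt_atTop 0] with T hT
  have h1 := (Commute.all T (T - a)).geom_sum₂_mul (d + 1)
  rw [← h1, sub_sub_cancel, mul_div_right_comm, Finset.sum_div]
  congr 1
  refine Finset.sum_congr rfl fun i hi => ?_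
  have hi' : i ≤ d := Nat.lt_succ_iff.1 (Finset.mem_range.1 hi)
  rw [show d + 1 - 1 - i = d - i by omega, div_pow]
  rw [div_eq_div_iff (by positivity) (by positivity)]
  have : T ^ d = T ^ i * T ^ (d - i) := by rw [← pow_add]; congr 1; omega
  rw [this]; ring

/-- After subtraction of `κ T^(d+1)`, whose step is asymptotic to `κ (d+1) a T^d = L T^d`, the
remainder has steps `o(T^d)` and is therefore `o(T^(d+1))`. -/
theorem tendsto_div_pow_succ_of_step {U : ℝ → ℝ} {L : ℝ} {d : ℕ} (ha : 0 < a)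
    (hb : ∀ R : ℝ, ∃ A, ∀ T, |T| ≤ R → |U T| ≤ A)
    (h : Tendsto (fun T => (U T - U (T - a)) / T ^ d) atTop (𝓝 L)) :
    Tendsto (fun T => U T / T ^ (d + 1)) atTop (𝓝 (L / ((d + 1) * a))) := by
  set κ := L / ((d + 1) * a)
  have hκ : L - κ * ((d + 1) * a) = 0 := by
    have : ((d : ℝ) + 1) * a ≠ 0 := by positivity
    simp only [κ]; field_simp; ring
  set V : ℝ → ℝ := fun T => U T - κ * T ^ (d + 1)
  have hV : Tendsto (fun T => (V T - V (T - a)) / T ^ d) atTop (𝓝 0) := by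
    rw [← hκ]
    refine (h.sub ((tendsto_pow_succ_step a d).const_mul κ)).congr fun T => ?_
    simp only [V]; ring
  have hVb : ∀ R : ℝ, ∃ A, ∀ T, |T| ≤ R → ‖V T‖ ≤ A := by
    intro R
    obtain ⟨A, hA⟩ := hb R
    refine ⟨A + |κ| * R ^ (d + 1), fun T hT => ?_⟩
    refine (norm_sub_le _ _).trans (add_le_add (hA T hT) ?_)
    rw [norm_mul, norm_pow, Real.norm_eq_abs, Real.norm_eq_abs]
    gcongr
  rw [Metric.tendsto_nhds]
  intro ε hε
  -- The constant `ε * a / 4` becomes `ε / 2` after the factor `2 / a` in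
  -- `eventually_norm_le_of_step_le`.
  have h1 : ∀ᶠ T in atTop, ‖V T - V (T - a)‖ ≤ ε * a / 4 * T ^ d := by
    filter_upwards [(Metric.tendsto_nhds.1 hV) (ε * a / 4) (by positivity),
      eventually_gt_atTop 0] with T h2 h3
    rw [dist_zero_right, norm_div, Real.norm_of_nonneg (pow_nonneg h3.le d),
      div_lt_iff₀ (by positivity)] at h2
    exact h2.le
  filter_upwards [eventually_norm_le_of_step_le ha (by positivity) hVb h1,
    eventually_gt_atTop 0] with T h2 h3
  have h4 : U T / T ^ (d + 1) - κ = V T / T ^ (d + 1) := by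
    simp only [V]; field_simp
  rw [Real.dist_eq, h4, abs_div, abs_of_pos (pow_pos h3 _), div_lt_iff₀ (by positivity)]
  have h5 : 2 * (ε * a / 4) / a = ε / 2 := by field_simp; ring
  rw [h5, Real.norm_eq_abs] at h2
  have : 0 < ε * T ^ (d + 1) := by positivity
  linarith

end

/-! ### Irrational rotations and asymptotic periodicity -/

/-- Along an irrational rotation, every continuous function on the circle is, up to a small
uniform error, a constant plus a bounded coboundary. -/
theorem exists_coboundary_approx {a b δ : ℝ} (hb : 0 < b) (hδ : 0 < δ)
    (hirr : ∀ n m : ℤ, n ≠ 0 → (n : ℝ) * a ≠ m * b) {Ψ : ℝ → ℝ} (hc : Continuous Ψ)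
    (hper : Function.Periodic Ψ b) :
    ∃ m : ℝ, ∃ Θ : ℝ → ℝ, (∃ A, ∀ T, |Θ T| ≤ A) ∧
      ∀ T, |Ψ T - m - (Θ T - Θ (T - a))| ≤ δ := by
  have : Fact (0 < b) := ⟨hb⟩
  -- For trigonometric polynomials the coboundary equation is solved exactly, one character at a
  -- time.
  have hspan : ∀ P ∈ Submodule.span ℂ (Set.range (@fourier b)), ∃ m : ℂ, ∃ Θ : ℝ → ℂ,
      (∃ A, ∀ T, ‖Θ T‖ ≤ A) ∧ ∀ T : ℝ, P (T : AddCircle b) = m + (Θ T - Θ (T - a)) := by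
    intro P hP
    induction hP using Submodule.span_induction with
    | mem P hP =>
      obtain ⟨n, rfl⟩ := hP
      by_cases hn : n = 0
      · subst hn
        exact ⟨1, 0, ⟨0, by simp⟩, by simp⟩
      -- Translation by `-a` multiplies the `n`-th character by `ζ`; incommensurability gives `ζ ≠
      -- 1`, so the character divided by `1 - ζ` solves the equation.
      · set ζ := Complex.exp (-(2 * Real.pi * Complex.I * n * a / b))
        have hbC : (b : ℂ) ≠ 0 := by exact_mod_cast hb.ne'
        have hζ : 1 - ζ ≠ 0 := by
          intro h
          obtain ⟨k, hk⟩ := Complex.exp_eq_one_iff.1 (sub_eq_zero.1 h).symm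
          refine hirr n (-k) hn ?_
          have h2 : (n : ℂ) * a = -k * b := by
            have hpi : (2 * Real.pi * Complex.I : ℂ) ≠ 0 := Complex.two_pi_I_ne_zero
            apply mul_left_cancel₀ hpi
            field_simp at hk
            linear_combination (-(2 * Real.pi * Complex.I : ℂ)) * hk
          exact_mod_cast h2
        have hsub : ∀ T : ℝ, fourier n ((T - a : ℝ) : AddCircle b) = fourier n (T : AddCircle b) * ζ := by
          intro T
          rw [fourier_coe_apply, fourier_coe_apply, ← Complex.exp_add]
          congr 1
          push_cast; ring
        refine ⟨0, fun T => fourier n (T : AddCircle b) * (1 - ζ)⁻¹, ⟨‖(1 - ζ)⁻¹‖, fun T => ?_⟩,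
          fun T => ?_⟩
        · rw [norm_mul, fourier_apply, Circle.norm_coe, one_mul]
        · simp only [hsub]
          field_simp
          ring
    | zero => exact ⟨0, 0, ⟨0, by simp⟩, by simp⟩
    | add P Q _ _ hP hQ =>
      obtain ⟨m, Θ, ⟨A, hA⟩, h⟩ := hP
      obtain ⟨m', Θ', ⟨A', hA'⟩, h'⟩ := hQ
      refine ⟨m + m', Θ + Θ', ⟨A + A', fun T => (norm_add_le _ _).trans (add_le_add (hA T) (hA' T))⟩,
        fun T => ?_⟩
      simp only [ContinuousMap.add_apply, h, h', Pi.add_apply]; ring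
    | smul z P _ hP =>
      obtain ⟨m, Θ, ⟨A, hA⟩, h⟩ := hP
      refine ⟨z * m, fun T => z * Θ T, ⟨‖z‖ * A, fun T => ?_⟩, fun T => ?_⟩
      · rw [norm_mul]; exact mul_le_mul_of_nonneg_left (hA T) (norm_nonneg _)
      · simp only [ContinuousMap.smul_apply, h, smul_eq_mul]; ring
  have hperC : Function.Periodic (fun T => (Ψ T : ℂ)) b := fun T => by simp [hper T]
  let F : C(AddCircle b, ℂ) := ⟨hperC.lift, continuous_coinduced_dom.mpr
    (show Continuous fun T => (Ψ T : ℂ) by fun_prop)⟩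
  -- Trigonometric polynomials are uniformly dense, which leaves an error of at most `δ`; real parts
  -- then bring the identity back to `ℝ`.
  have hF : F ∈ (Submodule.span ℂ (Set.range (@fourier b))).topologicalClosure := by
    rw [span_fourier_closure_eq_top]; trivial
  rw [← SetLike.mem_coe, Submodule.topologicalClosure_coe, Metric.mem_closure_iff] at hF
  obtain ⟨P, hP, hPF⟩ := hF δ hδ
  obtain ⟨m, Θ, ⟨A, hA⟩, h⟩ := hspan P hP
  refine ⟨m.re, fun T => (Θ T).re, ⟨A, fun T => (Complex.abs_re_le_norm _).trans (hA T)⟩,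
    fun T => ?_⟩
  have h1 : ‖(F - P) (T : AddCircle b)‖ ≤ δ :=
    ((F - P).norm_coe_le_norm _).trans (by rw [← dist_eq_norm]; exact hPF.le)
  have h2 : (F - P) (T : AddCircle b) = (Ψ T : ℂ) - (m + (Θ T - Θ (T - a))) := by
    rw [ContinuousMap.sub_apply, h]; rfl
  have h3 := (Complex.abs_re_le_norm _).trans h1
  rw [h2] at h3
  simpa [sub_sub] using h3

/-- A continuous function whose `b`-step decays exponentially is asymptotically `b`-periodic. -/
theorem exists_periodic_of_step_le {V : ℝ → ℝ} {b μ C : ℝ} (hb : 0 < b) (hμ : 0 < μ)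
    (hc : Continuous V) (hV : ∀ T, 0 ≤ T → |V (T + b) - V T| ≤ C * Real.exp (-(μ * T))) :
    ∃ Ψ : ℝ → ℝ, Continuous Ψ ∧ Function.Periodic Ψ b ∧
      Tendsto (fun T => V T - Ψ T) atTop (𝓝 0) := by
  set r := Real.exp (-(μ * b))
  have hr : r < 1 := by rw [Real.exp_lt_one_iff]; nlinarith [mul_pos hμ hb]
  have hr0 : 0 < r := Real.exp_pos _
  have hstep : ∀ T, 0 ≤ T → ∀ j : ℕ,
      dist (V (T + j * b)) (V (T + (j + 1 : ℕ) * b)) ≤ C * Real.exp (-(μ * T)) * r ^ j := by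
    intro T hT j
    have h := hV (T + j * b) (by positivity)
    rw [dist_comm, Real.dist_eq]
    have e1 : T + j * b + b = T + (j + 1 : ℕ) * b := by push_cast; ring
    rw [e1] at h
    refine h.trans (le_of_eq ?_)
    rw [mul_assoc, ← Real.exp_nat_mul, ← Real.exp_add]
    ring_nf
  have hex : ∀ T, ∃ L, Tendsto (fun j : ℕ => V (T + j * b)) atTop (𝓝 L) := by
    intro T
    obtain ⟨k, hk⟩ := exists_nat_ge (-T / b)
    rw [div_le_iff₀ hb] at hk
    obtain ⟨L, hL⟩ := cauchySeq_tendsto_of_complete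
      (cauchySeq_of_le_geometric r _ hr (hstep (T + k * b) (by linarith)))
    refine ⟨L, (tendsto_add_atTop_iff_nat k).1 (hL.congr fun j => ?_)⟩
    push_cast; ring_nf
  choose Ψ hΨ using hex
  have hper : Function.Periodic Ψ b := by
    intro T
    refine tendsto_nhds_unique (hΨ (T + b)) (((tendsto_add_atTop_iff_nat 1).2 (hΨ T)).congr
      fun j => ?_)
    push_cast; ring_nf
  have hdist : ∀ T, 0 ≤ T → ∀ j : ℕ,
      dist (V (T + j * b)) (Ψ T) ≤ C * Real.exp (-(μ * T)) * r ^ j / (1 - r) := fun T hT j =>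
    dist_le_of_le_geometric_of_tendsto r _ hr (hstep T hT) (hΨ T) j
  have hC : 0 ≤ C := by
    have := (abs_nonneg _).trans (hV 0 le_rfl)
    simpa using this
  have h1r : 0 < 1 - r := by linarith
  refine ⟨Ψ, ?_, hper, ?_⟩
  -- The convergence is uniform only on the half-line `T ≥ 0`; periodicity carries continuity of the
  -- limit to all of `ℝ`.
  · have hunif : TendstoUniformlyOn (fun (j : ℕ) T => V (T + j * b)) Ψ atTop (Set.Ici 0) := by
      rw [Metric.tendstoUniformlyOn_iff]
      intro ε hε
      have hlim : Tendsto (fun j : ℕ => C * r ^ j / (1 - r)) atTop (𝓝 (C * 0 / (1 - r))) :=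
        ((tendsto_pow_atTop_nhds_zero_of_lt_one hr0.le hr).const_mul C).div_const _
      rw [mul_zero, zero_div] at hlim
      filter_upwards [hlim.eventually_lt_const hε] with j hj T hT
      rw [dist_comm]
      refine ((hdist T hT j).trans ?_).trans_lt hj
      have : Real.exp (-(μ * T)) ≤ 1 := by
        rw [Real.exp_le_one_iff]
        have := mul_nonneg hμ.le (Set.mem_Ici.1 hT)
        linarith
      gcongr
      exact mul_le_of_le_one_right hC this
    have hcon : ContinuousOn Ψ (Set.Ici 0) :=
      hunif.continuousOn (Frequently.of_forall fun j => by fun_prop)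
    rw [continuous_iff_continuousAt]
    intro T
    obtain ⟨k, hk⟩ := exists_nat_gt (-T / b)
    rw [div_lt_iff₀ hb] at hk
    have h1 : ContinuousAt Ψ (T + k * b) :=
      hcon.continuousAt (Ici_mem_nhds (by linarith))
    have h2 : ContinuousAt (fun T => Ψ (T + k * b)) T :=
      ContinuousAt.comp (f := fun T => T + k * b) h1 (by fun_prop)
    refine h2.congr (Eventually.of_forall fun S => ?_)
    exact hper.nat_mul k S
  · have hlim : Tendsto (fun T : ℝ => C * Real.exp (-(μ * T)) / (1 - r)) atTop
        (𝓝 (C * 0 / (1 - r))) := by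
      refine (Tendsto.const_mul C (Real.tendsto_exp_atBot.comp ?_)).div_const _
      exact tendsto_neg_atTop_atBot.comp (tendsto_id.const_mul_atTop hμ)
    rw [mul_zero, zero_div] at hlim
    refine squeeze_zero_norm' ?_ hlim
    filter_upwards [eventually_ge_atTop 0] with T hT
    simpa [Real.dist_eq] using hdist T hT 0

/-- Replacing `Ψ` by `m` plus a bounded coboundary of `Θ`, up to `δ`, leaves `U(T) - (m/a) T - Θ(T)`
with steps at most `2δ` eventually, hence of size `O(δ T)`. Since `δ` is arbitrary, `U(T)/T` is
Cauchy; the limit need not be identified. -/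
theorem exists_tendsto_div_of_step_asymptotically_periodic {U Ψ : ℝ → ℝ} {a b : ℝ} (ha : 0 < a)
    (hb : 0 < b) (hirr : ∀ n m : ℤ, n ≠ 0 → (n : ℝ) * a ≠ m * b) (hc : Continuous Ψ)
    (hper : Function.Periodic Ψ b) (hbd : ∀ R : ℝ, ∃ A, ∀ T, |T| ≤ R → |U T| ≤ A)
    (hU : Tendsto (fun T => U T - U (T - a) - Ψ T) atTop (𝓝 0)) :
    ∃ L, Tendsto (fun T => U T / T) atTop (𝓝 L) := by
  -- Of the `5 * δ / a`, four parts come from the steps of size `2 * δ` and one absorbs the bounded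
  -- function `Θ`.
  have key : ∀ δ > 0, ∃ m, ∀ᶠ T in atTop, |U T / T - m| ≤ 5 * δ / a := by
    intro δ hδ
    obtain ⟨m, Θ, ⟨A, hA⟩, h⟩ := exists_coboundary_approx hb hδ hirr hc hper
    set V : ℝ → ℝ := fun T => U T - m / a * T - Θ T with hVdef
    have hVb : ∀ R : ℝ, ∃ A, ∀ T, |T| ≤ R → ‖V T‖ ≤ A := by
      intro R
      obtain ⟨A', hA'⟩ := hbd R
      refine ⟨A' + |m / a| * R + A, fun T hT => ?_⟩
      refine (norm_sub_le _ _).trans (add_le_add ((norm_sub_le _ _).trans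
        (add_le_add (hA' T hT) ?_)) (hA T))
      rw [norm_mul, Real.norm_eq_abs, Real.norm_eq_abs]
      gcongr
    have hstep : ∀ᶠ T in atTop, ‖V T - V (T - a)‖ ≤ 2 * δ * T ^ 0 := by
      filter_upwards [Metric.tendsto_nhds.1 hU δ hδ] with T hT
      rw [dist_zero_right, Real.norm_eq_abs] at hT
      have e : V T - V (T - a) = (U T - U (T - a) - Ψ T) + (Ψ T - m - (Θ T - Θ (T - a))) := by
        simp only [hVdef]; field_simp; ring
      rw [e, pow_zero, mul_one]
      refine (norm_add_le _ _).trans ?_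
      have := h T
      simp only [Real.norm_eq_abs]
      linarith
    refine ⟨m / a, ?_⟩
    have h2 : Tendsto (fun T : ℝ => δ / a * T) atTop atTop :=
      tendsto_id.const_mul_atTop (by positivity)
    filter_upwards [eventually_norm_le_of_step_le ha (by positivity) hVb hstep,
      eventually_gt_atTop 0, h2.eventually_ge_atTop A] with T h3 h4 h5
    have e : U T / T - m / a = (V T + Θ T) / T := by
      simp only [hVdef]; field_simp; ring
    rw [e, abs_div, abs_of_pos h4, div_le_iff₀ h4]
    refine (abs_add_le _ _).trans ?_
    have e2 : 5 * δ / a * T = 2 * (2 * δ) / a * T ^ (0 + 1) + δ / a * T := by ring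
    rw [e2]
    exact add_le_add h3 ((hA T).trans h5)
  refine cauchySeq_tendsto_of_complete (Metric.cauchySeq_iff'.2 fun ε hε => ?_)
  obtain ⟨m, hm⟩ := key (ε * a / 15) (by positivity)
  obtain ⟨N, hN⟩ := eventually_atTop.1 hm
  refine ⟨N, fun T hT => ?_⟩
  have h1 := hN T hT
  have h2 := hN N le_rfl
  have e : 5 * (ε * a / 15) / a = ε / 3 := by field_simp; ring
  rw [e] at h1 h2
  rw [Real.dist_eq]
  have := abs_sub_le (U T / T) m (U N / N)
  rw [abs_sub_comm m] at this
  linarith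

/-! ### Growth of shift sums with eventually constant weights -/

section

variable {w : ℕ → ℝ} {a c A : ℝ} {G : ℝ → ℝ}

/-- A single term suffices: the exponent `⌊T / a⌋` moves `T` into the compact interval `[0, a]`,
where `G` has a positive minimum. -/
theorem exists_pos_le_shiftSum {E : ℕ} (ha : 0 < a) (hw : ∀ e, 0 ≤ w e) (hc : 0 < c)
    (hE : ∀ e, E ≤ e → w e = c) (hG : ∀ T, |G T| ≤ A * Real.exp T) (hpos : ∀ T, 0 < G T)
    (hcont : Continuous G) : ∃ ψ, 0 < ψ ∧ ∀ᶠ T in atTop, ψ ≤ shiftSum w a G T := by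
  obtain ⟨D, hD0, hD⟩ := exists_bound_of_eventually_const (eventually_atTop.2 ⟨E, hE⟩)
  obtain ⟨t, -, ht⟩ := (isCompact_Icc (a := 0) (b := a)).exists_isMinOn
    (Set.nonempty_Icc.2 ha.le) hcont.continuousOn
  refine ⟨c * G t, mul_pos hc (hpos t), ?_⟩
  filter_upwards [eventually_ge_atTop (E * a), eventually_ge_atTop 0] with T hT hT0
  set e := ⌊T / a⌋₊
  have he : E ≤ e := Nat.le_floor (by rwa [le_div_iff₀ ha])
  have h1 : (e : ℝ) ≤ T / a := Nat.floor_le (by positivity)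
  have h2 : T / a < e + 1 := Nat.lt_floor_add_one _
  rw [le_div_iff₀ ha] at h1
  rw [div_lt_iff₀ ha] at h2
  have h3 : G t ≤ G (T - e * a) := ht ⟨by linarith, by linarith⟩
  calc c * G t ≤ w e * G (T - e * a) := by rw [hE e he]; gcongr
    _ ≤ _ := (summable_shiftSum ha hD0.le hD hG T).le_tsum e
        fun j _ => mul_nonneg (hw j) (hpos _).le

/-- About `T / a` of the shifted arguments stay in the range where `G ≥ ψ`, and each of them
contributes at least `c * ψ`. -/
theorem exists_pos_mul_le_shiftSum {E : ℕ} {ψ : ℝ} (ha : 0 < a) (hw : ∀ e, 0 ≤ w e) (hc : 0 < c)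
    (hE : ∀ e, E ≤ e → w e = c) (hG : ∀ T, |G T| ≤ A * Real.exp T) (hG0 : ∀ T, 0 ≤ G T)
    (hψ : 0 < ψ) (hGψ : ∀ᶠ T in atTop, ψ ≤ G T) :
    ∃ κ, 0 < κ ∧ ∀ᶠ T in atTop, κ * T ≤ shiftSum w a G T := by
  obtain ⟨D, hD0, hD⟩ := exists_bound_of_eventually_const (eventually_atTop.2 ⟨E, hE⟩)
  obtain ⟨T₀, hT₀⟩ := eventually_atTop.1 hGψ
  refine ⟨c * ψ / (2 * a), by positivity, ?_⟩
  filter_upwards [eventually_ge_atTop (2 * (T₀ + E * a)), eventually_ge_atTop T₀] with T hT hT'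
  set M := ⌊(T - T₀) / a⌋₊
  have hq : 0 ≤ (T - T₀) / a := div_nonneg (by linarith) ha.le
  have h1 : (M : ℝ) ≤ (T - T₀) / a := Nat.floor_le hq
  have h2 : (T - T₀) / a < M + 1 := Nat.lt_floor_add_one _
  rw [le_div_iff₀ ha] at h1
  rw [div_lt_iff₀ ha] at h2
  have h3 : ∑ e ∈ Finset.Ico E (M + 1), c * ψ ≤ ∑ e ∈ Finset.Ico E (M + 1), w e * G (T - e * a) := by
    refine Finset.sum_le_sum fun e he => ?_
    rw [Finset.mem_Ico] at he
    rw [hE e he.1]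
    refine mul_le_mul_of_nonneg_left (hT₀ _ ?_) hc.le
    have : (e : ℝ) ≤ M := by exact_mod_cast Nat.lt_succ_iff.1 he.2
    nlinarith
  rw [Finset.sum_const, Nat.card_Ico, nsmul_eq_mul] at h3
  have h4 : (M : ℝ) + 1 - E ≤ ((M + 1 - E : ℕ) : ℝ) := by
    have : M + 1 ≤ (M + 1 - E) + E := by omega
    have : ((M + 1 : ℕ) : ℝ) ≤ ((M + 1 - E) + E : ℕ) := by exact_mod_cast this
    push_cast at this ⊢; linarith
  have h5 : T / (2 * a) ≤ (M : ℝ) + 1 - E := by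
    rw [div_le_iff₀ (by positivity)]
    nlinarith
  calc c * ψ / (2 * a) * T = T / (2 * a) * (c * ψ) := by ring
    _ ≤ ((M + 1 - E : ℕ) : ℝ) * (c * ψ) := by gcongr; exact h5.trans h4
    _ ≤ _ := h3
    _ ≤ _ := (summable_shiftSum ha hD0.le hD hG T).sum_le_tsum _
        fun j _ => mul_nonneg (hw j) (hG0 _)

theorem firstDiff_eq_zero {E : ℕ} (hE : ∀ e, E ≤ e → w e = c) (e : ℕ) (he : E + 1 ≤ e) :
    firstDiff w e = 0 := by
  obtain ⟨k, rfl⟩ : ∃ k, e = k + 1 := ⟨e - 1, by omega⟩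
  simp [firstDiff, hE k (by omega), hE (k + 1) (by omega)]

/-- The step of the sum is a finite combination of shifts of `G`, hence exponentially small. -/
theorem shiftSum_asymptotically_periodic {E : ℕ} {μ C : ℝ} (ha : 0 < a) (hμ : 0 < μ)
    (hE : ∀ e, E ≤ e → w e = c) (hG : ∀ T, |G T| ≤ A * Real.exp T)
    (hG' : ∀ T, |G T| ≤ C * Real.exp (-(μ * T))) (hcont : Continuous G) :
    ∃ Ψ : ℝ → ℝ, Continuous Ψ ∧ Function.Periodic Ψ a ∧
      Tendsto (fun T => shiftSum w a G T - Ψ T) atTop (𝓝 0) := by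
  obtain ⟨D, hD0, hD⟩ := exists_bound_of_eventually_const (eventually_atTop.2 ⟨E, hE⟩)
  -- The difference equation is applied at `T + a`, whence the shifts `a - e * a` in the constant.
  refine exists_periodic_of_step_le
    (C := ∑ e ∈ Finset.range (E + 1), |firstDiff w e| * (C * Real.exp (-(μ * (a - e * a)))))
    ha hμ (continuous_shiftSum ha hD0.le hD hG hcont) fun T _ => ?_
  have h := shiftSum_sub_shift ha hD0.le hD hG (T + a)
  rw [add_sub_cancel_right] at h
  rw [h, shiftSum_eq_sum (firstDiff_eq_zero hE), Finset.sum_mul]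
  refine (Finset.abs_sum_le_sum_abs _ _).trans (Finset.sum_le_sum fun e _ => ?_)
  rw [abs_mul, mul_assoc, mul_assoc, ← Real.exp_add]
  refine mul_le_mul_of_nonneg_left ((hG' _).trans (le_of_eq ?_)) (abs_nonneg _)
  ring_nf

theorem exists_bound_on_bounded_of_exp_le {U : ℝ → ℝ} {A : ℝ} (h : ∀ T, |U T| ≤ A * Real.exp T)
    (R : ℝ) : ∃ A, ∀ T, |T| ≤ R → |U T| ≤ A := by
  have hA : 0 ≤ A := by
    have := (abs_nonneg _).trans (h 0)
    simpa using this
  exact ⟨A * Real.exp R, fun T hT => (h T).trans (by gcongr; exact (le_abs_self T).trans hT)⟩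

/-- Adding an eventually constant weight raises the order of growth by one. -/
theorem tendsto_shiftSum_div_pow_succ {E d : ℕ} {L : ℝ} (ha : 0 < a)
    (hE : ∀ e, E ≤ e → w e = c) (hG : ∀ T, |G T| ≤ A * Real.exp T)
    (hL : Tendsto (fun T => G T / T ^ d) atTop (𝓝 L)) :
    Tendsto (fun T => shiftSum w a G T / T ^ (d + 1)) atTop (𝓝 (c * L / ((d + 1) * a))) := by
  obtain ⟨D, hD0, hD⟩ := exists_bound_of_eventually_const (eventually_atTop.2 ⟨E, hE⟩)
  refine tendsto_div_pow_succ_of_step ha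
    (exists_bound_on_bounded_of_exp_le (abs_shiftSum_le ha hD0.le hD hG)) ?_
  have h := tendsto_shiftSum_of_finite (a := a) (firstDiff_eq_zero hE) hL
  rw [sum_range_firstDiff, hE E le_rfl] at h
  exact h.congr fun T => by rw [shiftSum_sub_shift ha hD0.le hD hG]

end

/-- Two eventually constant weights with incommensurable steps: linear growth. -/
theorem exists_tendsto_shiftSum_shiftSum_div {w w' : ℕ → ℝ} {a b c c' A C μ : ℝ} {G : ℝ → ℝ}
    {E E' : ℕ} (ha : 0 < a) (hb : 0 < b) (hirr : ∀ n m : ℤ, n ≠ 0 → (n : ℝ) * a ≠ m * b)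
    (hw : ∀ e, 0 ≤ w e) (hw' : ∀ e, 0 ≤ w' e) (hc : 0 < c) (hc' : 0 < c')
    (hE : ∀ e, E ≤ e → w e = c) (hE' : ∀ e, E' ≤ e → w' e = c') (hμ : 0 < μ)
    (hG : ∀ T, |G T| ≤ A * Real.exp T) (hG' : ∀ T, |G T| ≤ C * Real.exp (-(μ * T)))
    (hpos : ∀ T, 0 < G T) (hcont : Continuous G) :
    ∃ L, 0 < L ∧ Tendsto (fun T => shiftSum w a (shiftSum w' b G) T / T) atTop (𝓝 L) := by
  obtain ⟨D, hD0, hD⟩ := exists_bound_of_eventually_const (eventually_atTop.2 ⟨E, hE⟩)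
  obtain ⟨D', hD0', hD'⟩ := exists_bound_of_eventually_const (eventually_atTop.2 ⟨E', hE'⟩)
  set G₁ := shiftSum w' b G
  have hG₁ := abs_shiftSum_le hb hD0'.le hD' hG
  obtain ⟨Ψ, hΨc, hΨp, hΨ⟩ := shiftSum_asymptotically_periodic hb hμ hE' hG hG' hcont
  have hstep : Tendsto (fun T => shiftSum w a G₁ T - shiftSum w a G₁ (T - a) -
      ∑ e ∈ Finset.range (E + 1), firstDiff w e * Ψ (T - e * a)) atTop (𝓝 0) := by
    have h : Tendsto (fun T => ∑ e ∈ Finset.range (E + 1),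
        firstDiff w e * (G₁ (T - e * a) - Ψ (T - e * a))) atTop
        (𝓝 (∑ e ∈ Finset.range (E + 1), firstDiff w e * 0)) := by
      refine tendsto_finsetSum _ fun e _ => Tendsto.const_mul _ ?_
      exact hΨ.comp (tendsto_atTop_add_const_right _ (-(e * a)) tendsto_id)
    simp only [mul_zero, Finset.sum_const_zero] at h
    refine h.congr fun T => ?_
    rw [shiftSum_sub_shift ha hD0.le hD hG₁, shiftSum_eq_sum (firstDiff_eq_zero hE),
      ← Finset.sum_sub_distrib]
    exact Finset.sum_congr rfl fun e _ => by ring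
  obtain ⟨L, hL⟩ := exists_tendsto_div_of_step_asymptotically_periodic ha hb hirr
    (by fun_prop) (fun T => Finset.sum_congr rfl fun e _ => by
      rw [add_sub_right_comm, hΨp]) (exists_bound_on_bounded_of_exp_le
      (abs_shiftSum_le ha hD0.le hD hG₁)) hstep
  obtain ⟨ψ, hψ, hψG⟩ := exists_pos_le_shiftSum hb hw' hc' hE' hG hpos hcont
  obtain ⟨κ, hκ, hκG⟩ := exists_pos_mul_le_shiftSum ha hw hc hE hG₁
    (shiftSum_nonneg hw' fun T => (hpos T).le) hψ hψG
  -- The averaging argument yields only existence of the limit; its positivity comes from the linear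
  -- lower bound.
  refine ⟨L, hκ.trans_le (ge_of_tendsto hL ?_), hL⟩
  filter_upwards [hκG, eventually_gt_atTop 0] with T h1 h2
  rwa [le_div_iff₀ h2]

/-! ### Iterated sums over several primes -/

/-- The profile `min(e^T, e^{-(κ-1)T})`. -/
def profile (κ T : ℝ) : ℝ := min (Real.exp T) (Real.exp (-((κ - 1) * T)))

theorem profile_pos (κ T : ℝ) : 0 < profile κ T := lt_min (Real.exp_pos _) (Real.exp_pos _)

theorem continuous_profile (κ : ℝ) : Continuous (profile κ) := by
  unfold profile; fun_prop

theorem abs_profile_le_exp (κ T : ℝ) : |profile κ T| ≤ 1 * Real.exp T := by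
  rw [abs_of_pos (profile_pos κ T), one_mul]; exact min_le_left _ _

theorem abs_profile_le_exp_neg (κ T : ℝ) : |profile κ T| ≤ 1 * Real.exp (-((κ - 1) * T)) := by
  rw [abs_of_pos (profile_pos κ T), one_mul]; exact min_le_right _ _

/-- Iterated `shiftSum` over a list of primes. -/
def primeSum (w : Nat.Primes → ℕ → ℝ) (G : ℝ → ℝ) : List Nat.Primes → ℝ → ℝ
  | [] => G
  | p :: l => shiftSum (w p) (Real.log (p : ℕ)) (primeSum w G l)

/-- The truncation of `primeSum` to exponents less than `K`. -/
def primeSumTrunc (K : ℕ) (w : Nat.Primes → ℕ → ℝ) (G : ℝ → ℝ) : List Nat.Primes → ℝ → ℝ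
  | [] => G
  | p :: l => fun T => ∑ e ∈ Finset.range K,
      w p e * primeSumTrunc K w G l (T - e * Real.log (p : ℕ))

theorem log_prime_pos (p : Nat.Primes) : 0 < Real.log (p : ℕ) :=
  Real.log_pos (by exact_mod_cast p.2.one_lt)

theorem log_primes_incommensurable {p q : Nat.Primes} (hpq : p ≠ q) (n m : ℤ) (hn : n ≠ 0) :
    (n : ℝ) * Real.log (p : ℕ) ≠ m * Real.log (q : ℕ) := by
  intro h
  have hp := log_prime_pos p
  have hq := log_prime_pos q
  have habs : (n.natAbs : ℝ) * Real.log (p : ℕ) = m.natAbs * Real.log (q : ℕ) := by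
    have := congrArg abs h
    rw [abs_mul, abs_mul, abs_of_pos hp, abs_of_pos hq] at this
    simpa [Nat.cast_natAbs] using this
  rw [← Real.log_pow, ← Real.log_pow] at habs
  have h2 := Real.log_injOn_pos (Set.mem_Ioi.2 (pow_pos (by exact_mod_cast p.2.pos) _))
    (Set.mem_Ioi.2 (pow_pos (by exact_mod_cast q.2.pos) _)) habs
  have h3 : (p : ℕ) ^ n.natAbs = (q : ℕ) ^ m.natAbs := by exact_mod_cast h2
  have h4 : (p : ℕ) ∣ (q : ℕ) ^ m.natAbs := h3 ▸ dvd_pow_self _ (by simpa using hn)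
  exact hpq (Subtype.ext ((Nat.prime_dvd_prime_iff_eq p.2 q.2).1 (p.2.dvd_of_dvd_pow h4)))

/-- Nonnegative nonzero weights that are eventually constant. -/
structure IsWeight (w : ℕ → ℝ) (c : ℝ) : Prop where
  nonneg : ∀ e, 0 ≤ w e
  eventually_eq : ∃ E, ∀ e, E ≤ e → w e = c
  exists_pos : ∃ e, 0 < w e

theorem IsWeight.exists_bound {w : ℕ → ℝ} {c : ℝ} (h : IsWeight w c) :
    ∃ D, 0 < D ∧ ∀ e, |w e| ≤ D :=
  exists_bound_of_eventually_const (eventually_atTop.2 h.eventually_eq)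

section

variable {w : Nat.Primes → ℕ → ℝ} {c : Nat.Primes → ℝ} {G : ℝ → ℝ}

theorem primeSum_append (w : Nat.Primes → ℕ → ℝ) (G : ℝ → ℝ) (l l' : List Nat.Primes) :
    primeSum w G (l ++ l') = primeSum w (primeSum w G l') l := by
  induction l with
  | nil => rfl
  | cons p l ih => simp only [List.cons_append, primeSum, ih]

theorem primeSum_nonneg (hG : ∀ T, 0 ≤ G T) (l : List Nat.Primes) (hw : ∀ p ∈ l, IsWeight (w p) (c p)) :
    ∀ T, 0 ≤ primeSum w G l T := by
  induction l with
  | nil => exact hG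
  | cons p l ih =>
    exact shiftSum_nonneg (hw p (by simp)).nonneg (ih fun q hq => hw q (by simp [hq]))

theorem exists_abs_primeSum_le {A : ℝ} (hG : ∀ T, |G T| ≤ A * Real.exp T) (l : List Nat.Primes)
    (hw : ∀ p ∈ l, IsWeight (w p) (c p)) :
    ∃ A, ∀ T, |primeSum w G l T| ≤ A * Real.exp T := by
  induction l with
  | nil => exact ⟨A, hG⟩
  | cons p l ih =>
    obtain ⟨A', hA'⟩ := ih fun q hq => hw q (by simp [hq])
    obtain ⟨D, hD0, hD⟩ := (hw p (by simp)).exists_bound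
    exact ⟨_, abs_shiftSum_le (log_prime_pos p) hD0.le hD hA'⟩

theorem primeSumTrunc_le {A : ℝ} (hG : ∀ T, |G T| ≤ A * Real.exp T) (hG0 : ∀ T, 0 ≤ G T)
    (l : List Nat.Primes) (hw : ∀ p ∈ l, IsWeight (w p) (c p)) (K : ℕ) (T : ℝ) :
    primeSumTrunc K w G l T ≤ primeSum w G l T := by
  induction l generalizing T with
  | nil => exact le_rfl
  | cons p l ih =>
    have hl : ∀ q ∈ l, IsWeight (w q) (c q) := fun q hq => hw q (by simp [hq])
    obtain ⟨A', hA'⟩ := exists_abs_primeSum_le hG l hl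
    have hp := hw p (by simp)
    obtain ⟨D, hD0, hD⟩ := hp.exists_bound
    refine (Finset.sum_le_sum fun e _ => mul_le_mul_of_nonneg_left (ih hl _) (hp.nonneg e)).trans ?_
    exact (summable_shiftSum (log_prime_pos p) hD0.le hD hA' T).sum_le_tsum _
        fun j _ => mul_nonneg (hp.nonneg j) (primeSum_nonneg hG0 l hl _)

/-- The tail of a shift sum from exponent `K` on is again a shift sum, evaluated at `T - K log p`.
The growth bound `O(e^T)` then yields the factor `p^(-K) ≤ 2^(-K)`. -/
theorem exists_primeSum_sub_trunc_le {A : ℝ} (hG : ∀ T, |G T| ≤ A * Real.exp T)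
    (l : List Nat.Primes) (hw : ∀ p ∈ l, IsWeight (w p) (c p)) :
    ∃ A', 0 ≤ A' ∧ ∀ (K : ℕ) (T : ℝ),
      primeSum w G l T - primeSumTrunc K w G l T ≤ A' * Real.exp T * (1 / 2) ^ K := by
  induction l with
  | nil => exact ⟨0, le_rfl, fun K T => by simp [primeSum, primeSumTrunc]⟩
  | cons p l ih =>
    have hl : ∀ q ∈ l, IsWeight (w q) (c q) := fun q hq => hw q (by simp [hq])
    obtain ⟨A', hA', hdiff⟩ := ih hl
    obtain ⟨A₂, hA₂⟩ := exists_abs_primeSum_le hG l hl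
    have hp := hw p (by simp)
    obtain ⟨D, hD0, hD⟩ := hp.exists_bound
    have ha := log_prime_pos p
    set a := Real.log (p : ℕ)
    have hA₂0 : 0 ≤ A₂ := by
      have := (abs_nonneg _).trans (hA₂ 0)
      simpa using this
    set Z := ∑' e : ℕ, Real.exp (-(e * a))
    have hZ : 0 ≤ Z := tsum_nonneg fun e => Real.exp_nonneg _
    refine ⟨D * A' * Z + D * A₂ * Z, by positivity, fun K T => ?_⟩
    have hsum := summable_shiftSum ha hD0.le hD hA₂ T
    have h1 : primeSum w G (p :: l) T = (∑ e ∈ Finset.range K, w p e * primeSum w G l (T - e * a)) +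
        shiftSum (fun e => w p (e + K)) a (primeSum w G l) (T - K * a) := by
      rw [primeSum, shiftSum, ← hsum.sum_add_tsum_nat_add K, shiftSum]
      congr 1
      refine tsum_congr fun e => ?_
      push_cast; ring_nf
    have hexp : Real.exp (-(K * a)) ≤ (1 / 2) ^ K := by
      rw [← mul_neg, Real.exp_nat_mul]
      refine pow_le_pow_left₀ (Real.exp_nonneg _) ?_ _
      rw [Real.exp_neg, Real.exp_log (by exact_mod_cast p.2.pos), one_div]
      exact inv_anti₀ (by norm_num) (by exact_mod_cast p.2.two_le)
    have h2 : shiftSum (fun e => w p (e + K)) a (primeSum w G l) (T - K * a) ≤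
        D * A₂ * Z * Real.exp T * (1 / 2) ^ K := by
      refine (le_abs_self _).trans ((abs_shiftSum_le ha hD0.le (fun e => hD _) hA₂ _).trans ?_)
      rw [sub_eq_add_neg, Real.exp_add, ← mul_assoc]
      gcongr
    have h3 : (∑ e ∈ Finset.range K, w p e * primeSum w G l (T - e * a)) -
        primeSumTrunc K w G (p :: l) T ≤ D * A' * Z * Real.exp T * (1 / 2) ^ K := by
      rw [primeSumTrunc, ← Finset.sum_sub_distrib]
      calc _ ≤ ∑ e ∈ Finset.range K, D * A' * Real.exp T * (1 / 2) ^ K * Real.exp (-(e * a)) := by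
            refine Finset.sum_le_sum fun e _ => ?_
            rw [← mul_sub]
            calc _ ≤ w p e * (A' * Real.exp (T - e * a) * (1 / 2) ^ K) :=
                  mul_le_mul_of_nonneg_left (hdiff K _) (hp.nonneg e)
              _ ≤ D * (A' * Real.exp (T - e * a) * (1 / 2) ^ K) := by
                  gcongr; exact (le_abs_self _).trans (hD e)
              _ = _ := by rw [sub_eq_add_neg, Real.exp_add]; ring
        _ = D * A' * Real.exp T * (1 / 2) ^ K * ∑ e ∈ Finset.range K, Real.exp (-(e * a)) := by
            rw [Finset.mul_sum]
        _ ≤ D * A' * Real.exp T * (1 / 2) ^ K * Z := by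
            gcongr
            exact (summable_exp_neg_mul ha).sum_le_tsum _ fun _ _ => Real.exp_nonneg _
        _ = _ := by ring
    rw [h1]
    linarith

theorem sum_range_pos_of_isWeight {w : ℕ → ℝ} {E : ℕ} (hw : IsWeight w 0)
    (hE : ∀ e, E ≤ e → w e = 0) : 0 < ∑ e ∈ Finset.range E, w e := by
  obtain ⟨e, he⟩ := hw.exists_pos
  refine Finset.sum_pos' (fun e _ => hw.nonneg e) ⟨e, ?_, he⟩
  by_contra h
  rw [Finset.mem_range, not_lt] at h
  exact he.ne' (hE e h)

-- Induction on the list: a prime with positive final weight raises the power of `T` by one, while a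
-- prime with final weight zero multiplies the limit by the positive mass of a finitely supported
-- weight.
open Classical in
theorem exists_tendsto_primeSum {A C : ℝ} {d : ℕ} (hG : ∀ T, |G T| ≤ A * Real.exp T)
    (hC : 0 < C) (hGC : Tendsto (fun T => G T / T ^ d) atTop (𝓝 C)) (l : List Nat.Primes)
    (hw : ∀ p ∈ l, IsWeight (w p) (c p)) :
    ∃ C', 0 < C' ∧ Tendsto (fun T => primeSum w G l T / T ^ (d + (l.filter (0 < c ·)).length))
      atTop (𝓝 C') := by
  induction l with
  | nil => exact ⟨C, hC, by simpa [primeSum] using hGC⟩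
  | cons p l ih =>
    have hl : ∀ q ∈ l, IsWeight (w q) (c q) := fun q hq => hw q (by simp [hq])
    obtain ⟨C', hC', hlim⟩ := ih hl
    obtain ⟨A', hA'⟩ := exists_abs_primeSum_le hG l hl
    have hp := hw p (by simp)
    obtain ⟨E, hE⟩ := hp.eventually_eq
    have ha := log_prime_pos p
    by_cases hcp : 0 < c p
    · rw [List.filter_cons_of_pos (by simpa using hcp), List.length_cons, ← add_assoc]
      refine ⟨_, ?_, tendsto_shiftSum_div_pow_succ ha hE hA' hlim⟩
      positivity
    · rw [List.filter_cons_of_neg (by simpa using hcp)]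
      have hcp0 : c p = 0 := le_antisymm (not_lt.1 hcp) (hE E le_rfl ▸ hp.nonneg E)
      rw [hcp0] at hE hp
      exact ⟨_, mul_pos (sum_range_pos_of_isWeight hp hE) hC', tendsto_shiftSum_of_finite hE hlim⟩

theorem exists_bounds_primeSum {A ψ : ℝ} (hψ : 0 < ψ) (hG : ∀ᶠ T in atTop, ψ ≤ G T ∧ G T ≤ A)
    (l : List Nat.Primes) (hw : ∀ p ∈ l, IsWeight (w p) 0) :
    ∃ ψ' A', 0 < ψ' ∧ ∀ᶠ T in atTop, ψ' ≤ primeSum w G l T ∧ primeSum w G l T ≤ A' := by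
  induction l with
  | nil => exact ⟨ψ, A, hψ, hG⟩
  | cons p l ih =>
    obtain ⟨ψ', A', hψ', h⟩ := ih fun q hq => hw q (by simp [hq])
    have hp := hw p (by simp)
    obtain ⟨E, hE⟩ := hp.eventually_eq
    refine ⟨(∑ e ∈ Finset.range E, w p e) * ψ', (∑ e ∈ Finset.range E, w p e) * A',
      mul_pos (sum_range_pos_of_isWeight hp hE) hψ', ?_⟩
    have hall : ∀ᶠ T in atTop, ∀ e ∈ Finset.range E,
        ψ' ≤ primeSum w G l (T - e * Real.log (p : ℕ)) ∧
          primeSum w G l (T - e * Real.log (p : ℕ)) ≤ A' := by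
      rw [Filter.eventually_all_finset]
      intro e _
      exact (tendsto_atTop_add_const_right _ (-(e * Real.log (p : ℕ))) tendsto_id).eventually h
    filter_upwards [hall] with T hT
    rw [primeSum, shiftSum_eq_sum hE, Finset.sum_mul, Finset.sum_mul]
    exact ⟨Finset.sum_le_sum fun e he => mul_le_mul_of_nonneg_left (hT e he).1 (hp.nonneg e),
      Finset.sum_le_sum fun e he => mul_le_mul_of_nonneg_left (hT e he).2 (hp.nonneg e)⟩

open Classical in
/-- At least two primes with infinitely many exponents: an exact asymptotic. -/
theorem exists_list_tendsto_primeSum {κ : ℝ} (hκ : 1 < κ) (S : Finset Nat.Primes)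
    (hw : ∀ p ∈ S, IsWeight (w p) (c p)) (h2 : 2 ≤ (S.filter (0 < c ·)).card) :
    ∃ l : List Nat.Primes, l.Nodup ∧ l.toFinset = S ∧ ∃ C, 0 < C ∧
      Tendsto (fun T => primeSum w (profile κ) l T / T ^ ((S.filter (0 < c ·)).card - 1))
        atTop (𝓝 C) := by
  obtain ⟨p, hp, q, hq, hpq⟩ := Finset.one_lt_card.1 h2
  rw [Finset.mem_filter] at hp hq
  have hpS := hw p hp.1
  have hqS := hw q hq.1
  obtain ⟨E, hE⟩ := hpS.eventually_eq
  obtain ⟨E', hE'⟩ := hqS.eventually_eq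
  -- Two primes with positive final weight are placed innermost, since the irrational rotation
  -- argument starts from the bare profile. The counting argument works for any order of the list,
  -- so an order may be chosen.
  set l₀ := ((S.erase p).erase q).toList
  have hmem : ∀ x, x ∈ l₀ ↔ x ≠ q ∧ x ≠ p ∧ x ∈ S := by simp [l₀]
  have hw₀ : ∀ x ∈ l₀, IsWeight (w x) (c x) := fun x hx => hw x ((hmem x).1 hx).2.2
  have hnd : (l₀ ++ [p, q]).Nodup := by
    rw [List.nodup_append]
    refine ⟨Finset.nodup_toList _, by simp [hpq], ?_⟩
    intro x hx y hy
    have := (hmem x).1 hx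
    simp only [List.mem_cons, List.not_mem_nil, or_false] at hy
    rcases hy with rfl | rfl
    exacts [this.2.1, this.1]
  have htoF : (l₀ ++ [p, q]).toFinset = S := by
    ext x
    simp only [List.mem_toFinset, List.mem_append, hmem, List.mem_cons, List.not_mem_nil, or_false]
    constructor
    · rintro (h | rfl | rfl)
      exacts [h.2.2, hp.1, hq.1]
    · intro hx
      by_cases h1 : x = p <;> by_cases h2 : x = q <;> simp [h1, h2, hx]
  refine ⟨l₀ ++ [p, q], hnd, htoF, ?_⟩
  obtain ⟨L, hL, hlim⟩ := exists_tendsto_shiftSum_shiftSum_div (log_prime_pos p) (log_prime_pos q)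
    (log_primes_incommensurable hpq) hpS.nonneg hqS.nonneg hp.2 hq.2 hE hE' (sub_pos.2 hκ)
    (abs_profile_le_exp κ) (abs_profile_le_exp_neg κ) (profile_pos κ) (continuous_profile κ)
  obtain ⟨A, hA⟩ := exists_abs_primeSum_le (w := w) (c := c) (abs_profile_le_exp κ) [p, q] (by
    intro x hx
    simp only [List.mem_cons, List.not_mem_nil, or_false] at hx
    rcases hx with rfl | rfl
    exacts [hpS, hqS])
  obtain ⟨C, hC, hfin⟩ := exists_tendsto_primeSum (d := 1) hA hL (by simpa [primeSum] using hlim)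
    l₀ hw₀
  refine ⟨C, hC, ?_⟩
  have hcard : (S.filter (0 < c ·)).card - 1 = 1 + (l₀.filter (0 < c ·)).length := by
    have h3 : (S.filter (0 < c ·)) = ((l₀ ++ [p, q]).filter (0 < c ·)).toFinset := by
      rw [List.toFinset_filter, htoF]; simp
    rw [h3, List.toFinset_card_of_nodup (hnd.filter _)]
    simp [hp.2, hq.2]
    omega
  rw [hcard, primeSum_append]
  exact hfin

open Classical in
/-- Exactly one prime with infinitely many exponents: boundedness from both sides. -/
theorem exists_list_bounds_primeSum {κ : ℝ} (hκ : 1 < κ) (S : Finset Nat.Primes)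
    (hw : ∀ p ∈ S, IsWeight (w p) (c p)) (h1 : (S.filter (0 < c ·)).card = 1) :
    ∃ l : List Nat.Primes, l.Nodup ∧ l.toFinset = S ∧ ∃ ψ A, 0 < ψ ∧
      ∀ᶠ T in atTop, ψ ≤ primeSum w (profile κ) l T ∧ primeSum w (profile κ) l T ≤ A := by
  obtain ⟨p, hpf⟩ := Finset.card_eq_one.1 h1
  have hp : p ∈ S ∧ 0 < c p := by
    rw [← Finset.mem_filter (p := (0 < c ·)), hpf]; simp
  have hpS := hw p hp.1
  obtain ⟨E, hE⟩ := hpS.eventually_eq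
  -- The one prime with infinitely many exponents is summed innermost; the others then act by finite
  -- sums, which preserve two-sided bounds.
  set l₀ := (S.erase p).toList
  have hmem : ∀ x, x ∈ l₀ ↔ x ≠ p ∧ x ∈ S := by simp [l₀]
  have hw₀ : ∀ x ∈ l₀, IsWeight (w x) 0 := by
    intro x hx
    obtain ⟨hxp, hxS⟩ := (hmem x).1 hx
    have hx' := hw x hxS
    have hcx : c x = 0 := by
      obtain ⟨E, hE⟩ := hx'.eventually_eq
      refine le_antisymm (not_lt.1 fun h => hxp ?_) (hE E le_rfl ▸ hx'.nonneg E)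
      have : x ∈ S.filter (0 < c ·) := Finset.mem_filter.2 ⟨hxS, h⟩
      rw [hpf] at this
      simpa using this
    rwa [hcx] at hx'
  refine ⟨l₀ ++ [p], ?_, ?_, ?_⟩
  · rw [List.nodup_append]
    refine ⟨Finset.nodup_toList _, by simp, ?_⟩
    intro x hx y hy
    have := (hmem x).1 hx
    simp only [List.mem_cons, List.not_mem_nil, or_false] at hy
    exact hy ▸ this.1
  · ext x
    simp only [List.mem_toFinset, List.mem_append, hmem, List.mem_cons, List.not_mem_nil, or_false]
    constructor
    · rintro (h | rfl)
      exacts [h.2, hp.1]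
    · intro hx
      by_cases h1 : x = p <;> simp [h1, hx]
  · have ha := log_prime_pos p
    obtain ⟨ψ, hψ, hlow⟩ := exists_pos_le_shiftSum ha hpS.nonneg hp.2 hE (abs_profile_le_exp κ)
      (profile_pos κ) (continuous_profile κ)
    obtain ⟨Ψ, hΨc, hΨp, hΨ⟩ := shiftSum_asymptotically_periodic ha (sub_pos.2 hκ) hE
      (abs_profile_le_exp κ) (abs_profile_le_exp_neg κ) (continuous_profile κ)
    obtain ⟨B, hB⟩ := (hΨp.isBounded_of_continuous ha.ne' hΨc).exists_norm_le
    rw [primeSum_append]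
    refine (exists_bounds_primeSum (A := B + 1) hψ ?_ l₀ hw₀).imp fun ψ' h => h
    filter_upwards [hlow, hΨ.eventually_le_const zero_lt_one] with T h1 h2
    refine ⟨h1, ?_⟩
    have := (le_abs_self _).trans (hB _ ⟨T, rfl⟩)
    simp only [primeSum]
    linarith

end

/-! ### Density of the integers where a prime power divides f(x) exactly -/

theorem dvd_eval_iff_of_modEq (f : ℤ[X]) {k m x y : ℤ} (hk : k ∣ m) (h : x ≡ y [ZMOD m]) :
    k ∣ f.eval x ↔ k ∣ f.eval y := by
  have h1 : m ∣ f.eval x - f.eval y :=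
    ((Int.modEq_iff_dvd.1 h.symm).trans (sub_dvd_eval_sub x y f))
  exact dvd_iff_dvd_of_dvd_sub (hk.trans h1)

/-- The residues `r` modulo `p ^ (e + 1)` such that `p ^ e` divides `f(r)` exactly. -/
def exactResidues (f : ℤ[X]) (p e : ℕ) : Finset ℕ :=
  (Finset.range (p ^ (e + 1))).filter fun r =>
    (p : ℤ) ^ e ∣ f.eval (r : ℤ) ∧ ¬ (p : ℤ) ^ (e + 1) ∣ f.eval (r : ℤ)

/-- `p ^ e` times the density of the integers `x` such that `p ^ e` divides `f(x)` exactly. -/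
def residueWeight (f : ℤ[X]) (p : Nat.Primes) (e : ℕ) : ℝ :=
  (exactResidues f p e).card / (p : ℕ)

theorem mod_mem_exactResidues {f : ℤ[X]} {p e : ℕ} (hp : 0 < p) {x : ℤ}
    (h1 : (p : ℤ) ^ e ∣ f.eval x) (h2 : ¬ (p : ℤ) ^ (e + 1) ∣ f.eval x) :
    (x % ((p : ℤ) ^ (e + 1))).toNat ∈ exactResidues f p e := by
  have hpos : (0 : ℤ) < (p : ℤ) ^ (e + 1) := by positivity
  have h3 := Int.emod_nonneg x hpos.ne'
  have h4 := Int.emod_lt_of_pos x hpos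
  have h5 : x % (p : ℤ) ^ (e + 1) ≡ x [ZMOD (p : ℤ) ^ (e + 1)] := Int.mod_modEq _ _
  rw [exactResidues, Finset.mem_filter, Finset.mem_range, Int.toNat_of_nonneg h3,
    dvd_eval_iff_of_modEq f (pow_dvd_pow _ (Nat.le_succ e)) h5, dvd_eval_iff_of_modEq f dvd_rfl h5]
  refine ⟨?_, h1, h2⟩
  zify
  rwa [Int.toNat_of_nonneg h3]

section

variable {p : ℕ} [hp : Fact p.Prime]

/-- Write `F = (X - α) h` with `h(α) ≠ 0`. By the ultrametric inequality `‖h‖` is constant on the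
ball of radius `‖h(α)‖` about `α`, so `δ` is the valuation of `h(α)`. -/
theorem exists_norm_eval_eq_near_root {F : ℤ_[p][X]} (hF : F ≠ 0) {α : ℤ_[p]} (hα : F.IsRoot α)
    (hm : F.rootMultiplicity α ≤ 1) :
    ∃ δ : ℕ, ∀ x, ‖x - α‖ < (p : ℝ) ^ (-(δ : ℤ)) → ‖F.eval x‖ = ‖x - α‖ * (p : ℝ) ^ (-(δ : ℤ)) := by
  obtain ⟨h, hFh, hdvd⟩ := exists_eq_pow_rootMultiplicity_mul_and_not_dvd F hF α
  have hm1 : F.rootMultiplicity α = 1 := le_antisymm hm ((rootMultiplicity_pos hF).2 hα)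
  rw [hm1, pow_one] at hFh
  have hhα : h.eval α ≠ 0 := fun h0 => hdvd (dvd_iff_isRoot.2 h0)
  refine ⟨(h.eval α).valuation, fun x hx => ?_⟩
  rw [← PadicInt.norm_eq_zpow_neg_valuation hhα] at hx ⊢
  have hlip : ‖h.eval x - h.eval α‖ ≤ ‖x - α‖ := by
    obtain ⟨k, hk⟩ := sub_dvd_eval_sub x α h
    rw [hk, norm_mul]
    exact mul_le_of_le_one_right (norm_nonneg _) (PadicInt.norm_le_one k)
  have hnorm : ‖h.eval x‖ = ‖h.eval α‖ := by
    have h1 : ‖h.eval x + -h.eval α‖ < ‖-h.eval α‖ := by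
      rw [norm_neg, ← sub_eq_add_neg]; exact hlip.trans_lt hx
    rw [PadicInt.norm_eq_of_norm_add_lt_right h1, norm_neg]
  rw [hFh, eval_mul, norm_mul, hnorm]
  simp

/-- The ball is a single residue class modulo `p ^ k`, represented by `α.appr k`. -/
theorem card_range_filter_norm_sub_le (α : ℤ_[p]) {k M : ℕ} (hkM : k ≤ M)
    [DecidablePred fun r : ℕ => ‖(r : ℤ_[p]) - α‖ ≤ (p : ℝ) ^ (-(k : ℤ))] :
    ((Finset.range (p ^ M)).filter fun r : ℕ => ‖(r : ℤ_[p]) - α‖ ≤ (p : ℝ) ^ (-(k : ℤ))).card =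
      p ^ (M - k) := by
  have happr : ‖α - α.appr k‖ ≤ (p : ℝ) ^ (-(k : ℤ)) :=
    (PadicInt.norm_le_pow_iff_mem_span_pow _ _).2 (α.appr_spec k)
  have hiff : ∀ r : ℕ, ‖(r : ℤ_[p]) - α‖ ≤ (p : ℝ) ^ (-(k : ℤ)) ↔ r ≡ α.appr k [MOD p ^ k] := by
    intro r
    have h1 : ‖(r : ℤ_[p]) - α‖ ≤ (p : ℝ) ^ (-(k : ℤ)) ↔
        ‖((r - α.appr k : ℤ) : ℤ_[p])‖ ≤ (p : ℝ) ^ (-(k : ℤ)) := by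
      push_cast
      constructor <;> intro h
      · rw [← sub_add_sub_cancel _ α]
        exact (PadicInt.nonarchimedean _ _).trans (max_le h happr)
      · rw [← sub_add_sub_cancel _ (α.appr k : ℤ_[p])]
        exact (PadicInt.nonarchimedean _ _).trans (max_le h (by rwa [norm_sub_rev]))
    rw [h1, PadicInt.norm_int_le_pow_iff_dvd, ← Int.natCast_modEq_iff, Int.modEq_comm,
      Int.modEq_iff_dvd]
    push_cast; rfl
  have hpk : 0 < p ^ k := pow_pos hp.out.pos _
  have hpkQ : ((p : ℚ) ^ k) ≠ 0 := by exact_mod_cast hpk.ne'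
  simp_rw [hiff]
  have h2 := Nat.Ico_filter_modEq_card 0 (p ^ M) hpk (α.appr k)
  rw [← Finset.range_eq_Ico] at h2
  have h3 : (((p ^ M : ℕ) : ℚ) - (α.appr k : ℚ)) / ((p ^ k : ℕ) : ℚ) =
      (((0 : ℕ) : ℚ) - (α.appr k : ℚ)) / ((p ^ k : ℕ) : ℚ) + ((p ^ (M - k) : ℕ) : ℚ) := by
    have : (p : ℚ) ^ M = p ^ k * p ^ (M - k) := by rw [← pow_add]; congr 1; omega
    push_cast
    rw [this]; field_simp; ring
  rw [h3, Int.ceil_add_natCast, add_sub_cancel_left] at h2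
  have h4 : (0 : ℤ) ≤ ((p ^ (M - k) : ℕ) : ℤ) := Int.natCast_nonneg _
  rw [max_eq_left h4] at h2
  exact_mod_cast h2

-- For large `e`, divisibility by `p ^ e` forces `r` to be near a root by compactness of `ℤ_p`. Near
-- `α` it means `v(r - α) ≥ e - δ α`, and these balls are disjoint for distinct roots.
open Classical in
theorem exists_card_filter_dvd_eval (f : ℤ[X]) (hf : f ≠ 0)
    (hm : ∀ α : ℤ_[p], (f.map (Int.castRingHom ℤ_[p])).rootMultiplicity α ≤ 1) :
    ∃ (δ : ℤ_[p] → ℕ) (e₀ : ℕ), ∀ e M, e₀ ≤ e → e ≤ M →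
      ((Finset.range (p ^ M)).filter fun r : ℕ => (p : ℤ) ^ e ∣ f.eval (r : ℤ)).card =
        ∑ α ∈ (f.map (Int.castRingHom ℤ_[p])).roots.toFinset, p ^ (M - (e - δ α)) := by
  set F := f.map (Int.castRingHom ℤ_[p]) with hFdef
  have hF : F ≠ 0 := (Polynomial.map_ne_zero_iff (RingHom.injective_int _)).2 hf
  have hp1 : (1 : ℝ) < p := by exact_mod_cast hp.out.one_lt
  have hp0 : (0 : ℝ) < p := zero_lt_one.trans hp1
  have hex : ∀ α : ℤ_[p], ∃ δ : ℕ, F.IsRoot α → ∀ x, ‖x - α‖ < (p : ℝ) ^ (-(δ : ℤ)) →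
      ‖F.eval x‖ = ‖x - α‖ * (p : ℝ) ^ (-(δ : ℤ)) := by
    intro α
    by_cases hα : F.IsRoot α
    · obtain ⟨δ, hδ⟩ := exists_norm_eval_eq_near_root hF hα (hm α)
      exact ⟨δ, fun _ => hδ⟩
    · exact ⟨0, fun h => absurd h hα⟩
  choose δ hδ using hex
  have hmem : ∀ α, α ∈ F.roots.toFinset ↔ F.IsRoot α := fun α => by
    rw [Multiset.mem_toFinset, mem_roots hF]
  -- Outside the balls around the roots, `‖F‖` attains a positive minimum.
  have hcompact : ∃ m : ℕ, ∀ x, ‖F.eval x‖ ≤ (p : ℝ) ^ (-(m : ℤ)) →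
      ∃ α, F.IsRoot α ∧ ‖x - α‖ < (p : ℝ) ^ (-(δ α : ℤ)) := by
    set Z : Set ℤ_[p] := ⋂ α ∈ {α | F.IsRoot α}, {x | (p : ℝ) ^ (-(δ α : ℤ)) ≤ ‖x - α‖}
    have hZ : IsCompact Z := (isClosed_biInter fun α _ =>
      isClosed_le continuous_const (by fun_prop)).isCompact
    have hZmem : ∀ x, x ∉ Z → ∃ α, F.IsRoot α ∧ ‖x - α‖ < (p : ℝ) ^ (-(δ α : ℤ)) := by
      intro x hx
      simpa [Z] using hx
    rcases Z.eq_empty_or_nonempty with h0 | hne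
    · exact ⟨0, fun x _ => hZmem x (by simp [h0])⟩
    · obtain ⟨z, hz, hzmin⟩ := hZ.exists_isMinOn hne (f := fun x => ‖F.eval x‖) (by fun_prop)
      have hFz : 0 < ‖F.eval z‖ := by
        rw [norm_pos_iff]
        intro h0
        have h1 : (p : ℝ) ^ (-(δ z : ℤ)) ≤ ‖z - z‖ := Set.mem_iInter₂.1 hz z h0
        rw [sub_self, norm_zero] at h1
        exact absurd h1 (not_le.2 (zpow_pos hp0 _))
      obtain ⟨m, hm⟩ := PadicInt.exists_pow_neg_lt p hFz
      refine ⟨m, fun x hx => hZmem x fun hxZ => ?_⟩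
      exact absurd ((hzmin hxZ).trans hx) (not_le.2 hm)
  obtain ⟨m, hm'⟩ := hcompact
  -- If two balls meet, the centre of the smaller one lies in the larger one, where `F` vanishes
  -- only at the centre.
  have hdisj : ∀ α β x, F.IsRoot α → F.IsRoot β → ‖x - α‖ < (p : ℝ) ^ (-(δ α : ℤ)) →
      ‖x - β‖ < (p : ℝ) ^ (-(δ β : ℤ)) → α = β := by
    intro α β x hα hβ h1 h2
    have e1 := hδ α hα x h1
    have key : ∀ α β, F.IsRoot α → F.IsRoot β → ‖β - α‖ < (p : ℝ) ^ (-(δ α : ℤ)) → α = β := by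
      intro α β hα hβ h
      have h3 := hδ α hα β h
      rw [hβ.eq_zero, norm_zero, eq_comm, mul_eq_zero] at h3
      rcases h3 with h3 | h3
      · exact (sub_eq_zero.1 (norm_eq_zero.1 h3)).symm
      · exact absurd h3 (zpow_pos hp0 _).ne'
    have h3 : ‖β - α‖ ≤ max ‖x - β‖ ‖x - α‖ := by
      rw [← sub_add_sub_cancel β x α, norm_sub_rev x β]
      exact PadicInt.nonarchimedean _ _
    rcases le_total (δ α) (δ β) with h | h
    · refine key α β hα hβ (h3.trans_lt (max_lt (h2.trans_le ?_) h1))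
      exact zpow_le_zpow_right₀ hp1.le (by omega)
    · refine (key β α hβ hα ?_).symm
      rw [norm_sub_rev]
      refine h3.trans_lt (max_lt h2 (h1.trans_le ?_))
      exact zpow_le_zpow_right₀ hp1.le (by omega)
  -- The `m` serves compactness; `e ≥ 2 * δ α + 1` gives `e - δ α > δ α`, so the ball of radius `p ^
  -- (-(e - δ α))` lies inside the ball where the norm formula holds.
  refine ⟨δ, m + ∑ α ∈ F.roots.toFinset, (2 * δ α + 1), fun e M he heM => ?_⟩
  have hδe : ∀ α, F.IsRoot α → 2 * δ α + 1 ≤ e := by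
    intro α hα
    have := Finset.single_le_sum (f := fun α => 2 * δ α + 1) (fun _ _ => Nat.zero_le _)
      ((hmem α).2 hα)
    omega
  have hnear : ∀ α x, F.IsRoot α → ‖x - α‖ ≤ (p : ℝ) ^ (-((e - δ α : ℕ) : ℤ)) →
      ‖x - α‖ < (p : ℝ) ^ (-(δ α : ℤ)) := by
    intro α x hα h
    have := hδe α hα
    exact h.trans_lt (zpow_lt_zpow_right₀ hp1 (by omega))
  have hsplit : ∀ α, F.IsRoot α → (p : ℝ) ^ (-(e : ℤ)) =
      (p : ℝ) ^ (-((e - δ α : ℕ) : ℤ)) * (p : ℝ) ^ (-(δ α : ℤ)) := by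
    intro α hα
    have := hδe α hα
    rw [← zpow_add₀ hp0.ne']
    congr 1
    omega
  have hset : ((Finset.range (p ^ M)).filter fun r : ℕ => (p : ℤ) ^ e ∣ f.eval (r : ℤ)) =
      F.roots.toFinset.biUnion fun α => (Finset.range (p ^ M)).filter fun r : ℕ =>
        ‖(r : ℤ_[p]) - α‖ ≤ (p : ℝ) ^ (-((e - δ α : ℕ) : ℤ)) := by
    ext r
    simp only [Finset.mem_filter, Finset.mem_biUnion, hmem]
    have h1 : (p : ℤ) ^ e ∣ f.eval (r : ℤ) ↔ ‖F.eval (r : ℤ_[p])‖ ≤ (p : ℝ) ^ (-(e : ℤ)) := by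
      have h2 : F.eval (r : ℤ_[p]) = ((f.eval (r : ℤ) : ℤ) : ℤ_[p]) := by
        simp [hFdef]
      rw [h2, PadicInt.norm_int_le_pow_iff_dvd]
    rw [h1]
    constructor
    · rintro ⟨hr, h⟩
      obtain ⟨α, hα, hxα⟩ := hm' _ (h.trans (zpow_le_zpow_right₀ hp1.le (by omega)))
      refine ⟨α, hα, hr, ?_⟩
      rw [hδ α hα _ hxα, hsplit α hα] at h
      exact le_of_mul_le_mul_right h (zpow_pos hp0 _)
    · rintro ⟨α, hα, hr, h⟩
      refine ⟨hr, ?_⟩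
      rw [hδ α hα _ (hnear α _ hα h), hsplit α hα]
      exact mul_le_mul_of_nonneg_right h (zpow_pos hp0 _).le
  rw [hset, Finset.card_biUnion]
  · exact Finset.sum_congr rfl fun α hα => card_range_filter_norm_sub_le α (by omega)
  · intro α hα β hβ hne
    refine Finset.disjoint_left.2 fun r h1 h2 => ?_
    rw [Finset.mem_filter] at h1 h2
    rw [Finset.mem_coe, hmem] at hα hβ
    exact hne (hdisj α β r hα hβ (hnear α _ hα h1.2) (hnear β _ hβ h2.2))

end

/-- Subtracting the counts for `p ^ (e + 1)` from those for `p ^ e`, both modulo `p ^ (e + 1)`,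
leaves `p ^ (δ α + 1) - p ^ δ α` for each root `α`: positive and independent of `e`. Without roots
the eventual value is the empty sum, and the weight is still nonzero because `f` has a nonzero
value. -/
theorem exists_isWeight_residueWeight (f : ℤ[X]) (hf : f ≠ 0) (p : Nat.Primes)
    (hm : ∀ α : ℤ_[(p : ℕ)], (toPadic f p).rootMultiplicity α ≤ 1) :
    ∃ c, IsWeight (residueWeight f p) c ∧
      (0 < c ↔ ∃ α : ℤ_[(p : ℕ)], (toPadic f p).IsRoot α) := by
  classical
  obtain ⟨δ, e₀, h⟩ := exists_card_filter_dvd_eval f hf hm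
  have hF : toPadic f p ≠ 0 := (Polynomial.map_ne_zero_iff (RingHom.injective_int _)).2 hf
  change ∀ e M, e₀ ≤ e → e ≤ M → _ = ∑ α ∈ (toPadic f p).roots.toFinset, _ at h
  set R := (toPadic f p).roots.toFinset
  have hp0 : (0 : ℝ) < (p : ℕ) := by exact_mod_cast p.2.pos
  have hp1 : (1 : ℝ) < (p : ℕ) := by exact_mod_cast p.2.one_lt
  refine ⟨(∑ α ∈ R, (((p : ℕ) : ℝ) ^ (δ α + 1) - ((p : ℕ) : ℝ) ^ δ α)) / (p : ℕ), ⟨?_, ?_, ?_⟩, ?_⟩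
  · exact fun e => by unfold residueWeight; positivity
  · refine ⟨e₀ + ∑ α ∈ R, δ α, fun e he => ?_⟩
    rw [residueWeight]
    congr 1
    have hδe : ∀ α ∈ R, δ α ≤ e := fun α hα =>
      (Finset.single_le_sum (f := δ) (fun _ _ => Nat.zero_le _) hα).trans (by omega)
    have h1 := h e (e + 1) (by omega) (by omega)
    have h2 := h (e + 1) (e + 1) (by omega) le_rfl
    have h3 : (exactResidues f p e).card + ((Finset.range ((p : ℕ) ^ (e + 1))).filter fun r : ℕ =>
        ((p : ℕ) : ℤ) ^ (e + 1) ∣ f.eval (r : ℤ)).card =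
        ((Finset.range ((p : ℕ) ^ (e + 1))).filter fun r : ℕ =>
        ((p : ℕ) : ℤ) ^ e ∣ f.eval (r : ℤ)).card := by
      rw [exactResidues, ← Finset.card_union_of_disjoint]
      · congr 1
        ext r
        simp only [Finset.mem_union, Finset.mem_filter]
        have : ((p : ℕ) : ℤ) ^ (e + 1) ∣ f.eval (r : ℤ) → ((p : ℕ) : ℤ) ^ e ∣ f.eval (r : ℤ) :=
          (pow_dvd_pow _ (Nat.le_succ e)).trans
        tauto
      · rw [Finset.disjoint_left]
        intro r h1 h2
        rw [Finset.mem_filter] at h1 h2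
        exact h1.2.2 h2.2
    rw [h1, h2] at h3
    have h4 : ∑ α ∈ R, (p : ℕ) ^ (e + 1 - (e + 1 - δ α)) = ∑ α ∈ R, (p : ℕ) ^ δ α :=
      Finset.sum_congr rfl fun α hα => by
        have := hδe α hα
        congr 1; omega
    have h5 : ∑ α ∈ R, (p : ℕ) ^ (e + 1 - (e - δ α)) = ∑ α ∈ R, (p : ℕ) ^ (δ α + 1) :=
      Finset.sum_congr rfl fun α hα => by
        have := hδe α hα
        congr 1; omega
    rw [h4, h5] at h3
    rw [Finset.sum_sub_distrib]
    have h6 : ((exactResidues f p e).card : ℝ) + ((∑ α ∈ R, (p : ℕ) ^ δ α : ℕ) : ℝ) =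
        ((∑ α ∈ R, (p : ℕ) ^ (δ α + 1) : ℕ) : ℝ) := by exact_mod_cast h3
    push_cast at h6
    linarith
  · obtain ⟨x, hx⟩ : ∃ x : ℤ, f.eval x ≠ 0 := by
      by_contra! h0
      exact hf (Polynomial.funext fun x => by simpa using h0 x)
    have h1 := (padicValInt_dvd_iff (p := (p : ℕ)) (padicValInt (p : ℕ) (f.eval x)) (f.eval x)).2
      (Or.inr le_rfl)
    have h2 : ¬ ((p : ℕ) : ℤ) ^ (padicValInt (p : ℕ) (f.eval x) + 1) ∣ f.eval x := by
      rw [padicValInt_dvd_iff]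
      omega
    refine ⟨padicValInt (p : ℕ) (f.eval x), div_pos ?_ hp0⟩
    exact_mod_cast Finset.card_pos.2 ⟨_, mod_mem_exactResidues p.2.pos h1 h2⟩
  · have hmem : ∀ α, α ∈ R ↔ (toPadic f p).IsRoot α := fun α => by
      rw [Multiset.mem_toFinset, mem_roots hF]
    have hterm : ∀ α ∈ R, 0 < ((p : ℕ) : ℝ) ^ (δ α + 1) - ((p : ℕ) : ℝ) ^ δ α := fun α _ =>
      sub_pos.2 (pow_lt_pow_right₀ hp1 (Nat.lt_succ_self _))
    constructor
    · intro h0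
      by_contra! hno
      have : R = ∅ := Finset.eq_empty_of_forall_notMem fun α hα => hno α ((hmem α).1 hα)
      simp [this] at h0
    · rintro ⟨α, hα⟩
      exact div_pos (Finset.sum_pos hterm ⟨α, (hmem α).2 hα⟩) hp0

/-! ### Counting level sets by residue classes -/

theorem exists_int_modEq_and_modEq {m n : ℤ} (h : IsCoprime m n) (a b : ℤ) :
    ∃ c, c ≡ a [ZMOD m] ∧ c ≡ b [ZMOD n] := by
  obtain ⟨u, v, huv⟩ := h
  refine ⟨a * (v * n) + b * (u * m), ?_, ?_⟩
  · refine (Int.modEq_iff_dvd.2 ⟨(a - b) * u, ?_⟩)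
    linear_combination (-a) * huv
  · refine (Int.modEq_iff_dvd.2 ⟨(b - a) * v, ?_⟩)
    linear_combination (-b) * huv

/-- One unit of error comes from the two floors in the exact count, the other from replacing `2⌊R⌋ +
1` by `2R`. -/
theorem abs_card_filter_modEq_sub_le {N : ℤ} {R : ℝ} (hR : 0 ≤ R) (hRN : R ≤ N) {Q : ℕ}
    (hQ : 0 < Q) (r : ℤ) [DecidablePred fun x : ℤ => x ≡ r [ZMOD Q] ∧ |(x : ℝ)| ≤ R] :
    |(((Finset.Icc (-N) N).filter fun x : ℤ => x ≡ r [ZMOD Q] ∧ |(x : ℝ)| ≤ R).card : ℝ) -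
      2 * R / Q| ≤ 2 := by
  have hset : ((Finset.Icc (-N) N).filter fun x : ℤ => x ≡ r [ZMOD Q] ∧ |(x : ℝ)| ≤ R) =
      (Finset.Ioc (-⌊R⌋ - 1) ⌊R⌋).filter fun x : ℤ => x ≡ r [ZMOD Q] := by
    ext x
    have hfl : ⌊R⌋ ≤ N := by exact_mod_cast (Int.floor_le R).trans hRN
    have h1 : |(x : ℝ)| ≤ R ↔ |x| ≤ ⌊R⌋ := by
      rw [Int.le_floor]; push_cast; rfl
    rw [Finset.mem_filter, Finset.mem_filter, Finset.mem_Icc, Finset.mem_Ioc, h1, abs_le]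
    constructor
    · rintro ⟨-, h2, h3, h4⟩
      exact ⟨⟨by omega, h4⟩, h2⟩
    · rintro ⟨⟨h3, h4⟩, h2⟩
      exact ⟨⟨by omega, by omega⟩, h2, by omega, h4⟩
  have hcard := Int.Ioc_filter_modEq_card (-⌊R⌋ - 1) ⌊R⌋ (r := (Q : ℤ)) (by exact_mod_cast hQ) r
  rw [hset]
  set n := ((Finset.Ioc (-⌊R⌋ - 1) ⌊R⌋).filter fun x : ℤ => x ≡ r [ZMOD Q]).card
  have hQ0 : (0 : ℚ) < Q := by exact_mod_cast hQ
  set y : ℚ := ((⌊R⌋ : ℚ) - r) / ((Q : ℤ) : ℚ)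
  set z : ℚ := (((-⌊R⌋ - 1 : ℤ) : ℚ) - r) / ((Q : ℤ) : ℚ)
  have hyz : y - z = (2 * (⌊R⌋ : ℚ) + 1) / Q := by
    simp only [y, z]; push_cast; field_simp; ring
  have hfl0 : 0 ≤ ⌊R⌋ := Int.floor_nonneg.2 hR
  have hzy : z ≤ y := by
    have : (0 : ℚ) ≤ (2 * (⌊R⌋ : ℚ) + 1) / Q := by
      have : (0 : ℚ) ≤ (⌊R⌋ : ℚ) := by exact_mod_cast hfl0
      positivity
    linarith
  rw [max_eq_left (sub_nonneg.2 (Int.floor_le_floor hzy))] at hcard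
  have h1 : |((⌊y⌋ - ⌊z⌋ : ℤ) : ℚ) - (y - z)| ≤ 1 := by
    have a1 := Int.floor_le y
    have a2 := Int.lt_floor_add_one y
    have a3 := Int.floor_le z
    have a4 := Int.lt_floor_add_one z
    push_cast
    rw [abs_le]
    constructor <;> linarith
  rw [← hcard, hyz] at h1
  have h2 : |(n : ℝ) - (2 * (⌊R⌋ : ℝ) + 1) / Q| ≤ 1 := by exact_mod_cast h1
  have hQ1 : (1 : ℝ) ≤ Q := by exact_mod_cast hQ
  have h3 : |(2 * (⌊R⌋ : ℝ) + 1) / Q - 2 * R / Q| ≤ 1 := by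
    rw [← sub_div, abs_div, abs_of_pos (zero_lt_one.trans_le hQ1), div_le_one (by linarith)]
    have a1 := Int.floor_le R
    have a2 := Int.lt_floor_add_one R
    refine le_trans ?_ hQ1
    rw [abs_le]
    constructor <;> linarith
  have := abs_sub_le (n : ℝ) ((2 * (⌊R⌋ : ℝ) + 1) / Q) (2 * R / Q)
  linarith

/-- The part of `f(x)` composed of the primes in a list. -/
def listPart (f : ℤ[X]) (l : List Nat.Primes) (x : ℤ) : ℝ :=
  (l.map fun p : Nat.Primes => ((p : ℕ) : ℝ) ^ padicValInt (p : ℕ) (f.eval x)).prod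

theorem listPart_pos (f : ℤ[X]) (l : List Nat.Primes) (x : ℤ) : 0 < listPart f l x := by
  refine List.prod_pos fun a ha => ?_
  obtain ⟨p, -, rfl⟩ := List.mem_map.1 ha
  exact pow_pos (by exact_mod_cast p.2.pos) _

open Classical in
/-- The integers `x ∈ [-N, N]` in a residue class for which `p ^ K ∤ f(x)` for the primes of a list,
and that are bounded in terms of the part of `f(x)` composed of these primes. -/
def levelSet (f : ℤ[X]) (G : ℝ → ℝ) (N : ℤ) (K : ℕ) (B : ℝ) (l : List Nat.Primes) (s : ℝ) (Q : ℕ)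
    (r : ℤ) : Finset ℤ :=
  (Finset.Icc (-N) N).filter fun x => x ≡ r [ZMOD Q] ∧
    (∀ p ∈ l, ¬ ((p : ℕ) : ℤ) ^ K ∣ f.eval x) ∧
    |(x : ℝ)| ≤ B * Real.exp (-s) * listPart f l x * G (s - Real.log (listPart f l x))

/-- The bound `G T ≤ e^T` keeps the radius below `B ≤ N`, so the restriction to `[-N, N]`, needed
only for finiteness, is harmless. -/
theorem card_levelSet_nil {f : ℤ[X]} {G : ℝ → ℝ} (hG0 : ∀ T, 0 ≤ G T)
    (hG : ∀ T, G T ≤ Real.exp T) {N : ℤ} {B : ℝ} (hB : 0 ≤ B) (hBN : B ≤ N) (K : ℕ) {Q : ℕ}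
    (hQ : 0 < Q) (r : ℤ) (s : ℝ) :
    |((levelSet f G N K B [] s Q r).card : ℝ) - 2 * B * Real.exp (-s) / Q * G s| ≤ 2 := by
  have h0 : 0 ≤ B * Real.exp (-s) * G s := by have := hG0 s; positivity
  have h1 : B * Real.exp (-s) * G s ≤ N := by
    refine le_trans ?_ hBN
    rw [mul_assoc]
    refine mul_le_of_le_one_right hB ?_
    calc Real.exp (-s) * G s ≤ Real.exp (-s) * Real.exp s := by gcongr; exact hG s
      _ = 1 := by rw [← Real.exp_add]; simp
  classical
  have h := abs_card_filter_modEq_sub_le h0 h1 hQ r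
  have e : 2 * B * Real.exp (-s) / Q * G s = 2 * (B * Real.exp (-s) * G s) / Q := by ring
  rw [e]
  convert h using 6
  ext x
  simp [levelSet, listPart]

theorem padicValInt_eq_iff {p : ℕ} [Fact p.Prime] {e : ℕ} {y : ℤ} :
    (y ≠ 0 ∧ padicValInt p y = e) ↔ ((p : ℤ) ^ e ∣ y ∧ ¬ (p : ℤ) ^ (e + 1) ∣ y) := by
  rw [padicValInt_dvd_iff, padicValInt_dvd_iff]
  by_cases hy : y = 0
  · simp [hy]
  · simp only [hy, ne_eq, not_false_eq_true, true_and, false_or]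
    omega

/-- Splitting the level set according to the exact power of a prime dividing `f(x)`. -/
theorem levelSet_fiber {f : ℤ[X]} {G : ℝ → ℝ} {N : ℤ} {B : ℝ} {K : ℕ} {p : Nat.Primes}
    {l : List Nat.Primes} {s : ℝ} {Q : ℕ} {r : ℤ} (hQp : Q.Coprime p) {e ρ : ℕ}
    (he : e < K) (hρ : ρ ∈ exactResidues f p e) :
    ∃ r', (levelSet f G N K B (p :: l) s Q r).filter (fun x =>
      (⟨padicValInt (p : ℕ) (f.eval x),
        (x % (((p : ℕ) : ℤ) ^ (padicValInt (p : ℕ) (f.eval x) + 1))).toNat⟩ : Σ _ : ℕ, ℕ) =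
        ⟨e, ρ⟩) =
      levelSet f G N K B l (s - e * Real.log (p : ℕ)) (Q * (p : ℕ) ^ (e + 1)) r' := by
  have hcop : Q.Coprime ((p : ℕ) ^ (e + 1)) := hQp.pow_right _
  obtain ⟨r', hr1, hr2⟩ := exists_int_modEq_and_modEq (Nat.isCoprime_iff_coprime.2 hcop) r ρ
  refine ⟨r', ?_⟩
  have hp0 : (0 : ℝ) < (p : ℕ) := by exact_mod_cast p.2.pos
  rw [exactResidues, Finset.mem_filter, Finset.mem_range] at hρ
  obtain ⟨hρlt, hρ1, hρ2⟩ := hρ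
  -- Removing the factor `p ^ e` from the list part amounts to replacing `s` by `s - e log p`; this
  -- matches the recursion of `primeSumTrunc`.
  have hsize : ∀ x, padicValInt (p : ℕ) (f.eval x) = e →
      B * Real.exp (-s) * listPart f (p :: l) x * G (s - Real.log (listPart f (p :: l) x)) =
      B * Real.exp (-(s - e * Real.log (p : ℕ))) * listPart f l x *
        G (s - e * Real.log (p : ℕ) - Real.log (listPart f l x)) := by
    intro x hx
    have h1 : listPart f (p :: l) x = ((p : ℕ) : ℝ) ^ e * listPart f l x := by
      simp [listPart, hx]
    have h2 : Real.exp (-(s - e * Real.log (p : ℕ))) = Real.exp (-s) * ((p : ℕ) : ℝ) ^ e := by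
      rw [neg_sub, sub_eq_neg_add, Real.exp_add, Real.exp_nat_mul, Real.exp_log hp0]
    rw [h1, h2, Real.log_mul (pow_pos hp0 _).ne' (listPart_pos f l x).ne', Real.log_pow, sub_sub]
    ring
  ext x
  simp only [levelSet, Finset.mem_filter, List.forall_mem_cons, Sigma.mk.injEq, heq_eq_eq,
    Nat.cast_mul, Nat.cast_pow]
  rw [← Int.modEq_and_modEq_iff_modEq_mul (by simpa using hcop)]
  constructor
  · rintro ⟨⟨hI, hr, ⟨hK, hl⟩, hx⟩, hv, hxρ⟩
    rw [hv] at hxρ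
    rw [hsize x hv] at hx
    refine ⟨hI, ⟨hr.trans hr1.symm, ?_⟩, hl, hx⟩
    have hpos : (0 : ℤ) < ((p : ℕ) : ℤ) ^ (e + 1) := pow_pos (by exact_mod_cast p.2.pos) _
    have h4 : x % ((p : ℕ) : ℤ) ^ (e + 1) = ρ := by
      rw [← hxρ, Int.toNat_of_nonneg (Int.emod_nonneg x hpos.ne')]
    have h5 : x ≡ ρ [ZMOD ((p : ℕ) : ℤ) ^ (e + 1)] := h4 ▸ (Int.mod_modEq _ _).symm
    refine h5.trans ?_
    simpa using hr2.symm
  · rintro ⟨hI, ⟨hxr, hxp⟩, hl, hx⟩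
    have h5 : x ≡ ρ [ZMOD ((p : ℕ) : ℤ) ^ (e + 1)] := by
      refine hxp.trans ?_
      simpa using hr2
    have h6 := padicValInt_eq_iff.2 ⟨(dvd_eval_iff_of_modEq f (pow_dvd_pow _ (Nat.le_succ e)) h5).2 hρ1,
      fun h => hρ2 ((dvd_eval_iff_of_modEq f dvd_rfl h5).1 h)⟩
    rw [hsize x h6.2, h6.2]
    refine ⟨⟨hI, hxr.trans hr1, ⟨fun h => ?_, hl⟩, hx⟩, rfl, ?_⟩
    · rw [padicValInt_dvd_iff] at h
      have := h6.1
      have := h6.2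
      omega
    · have h7 : x % ((p : ℕ) : ℤ) ^ (e + 1) = (ρ : ℤ) % ((p : ℕ) : ℤ) ^ (e + 1) := h5
      rw [h7, Int.emod_eq_of_lt (Int.natCast_nonneg _) (by exact_mod_cast hρlt), Int.toNat_natCast]

/-- Each prime splits the set into at most `D * K` classes, over exponents `e < K` and residues
modulo `p ^ (e + 1)`, so the error is multiplied by `D * K`. In the main term the shift of `s` gives
`p ^ e` and the new modulus gives `p ^ (-(e + 1))`; with the number of residues they make
`residueWeight f p e`. -/
theorem abs_card_levelSet_sub_le {f : ℤ[X]} {G : ℝ → ℝ} (hG0 : ∀ T, 0 ≤ G T)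
    (hG : ∀ T, G T ≤ Real.exp T) {N : ℤ} {B D : ℝ} (hB : 0 ≤ B) (hBN : B ≤ N) (hD0 : 0 ≤ D) (K : ℕ)
    (l : List Nat.Primes) (hnd : l.Nodup)
    (hD : ∀ p ∈ l, ∀ e, ((exactResidues f (p : ℕ) e).card : ℝ) ≤ D) (Q : ℕ) (hQ : 0 < Q)
    (hcop : ∀ p ∈ l, Q.Coprime (p : ℕ)) (r : ℤ) (s : ℝ) :
    |((levelSet f G N K B l s Q r).card : ℝ) -
      2 * B * Real.exp (-s) / Q * primeSumTrunc K (residueWeight f) G l s| ≤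
      2 * (D * K) ^ l.length := by
  induction l generalizing Q r s with
  | nil => simpa [primeSumTrunc] using card_levelSet_nil hG0 hG hB hBN K hQ r s
  | cons p l ih =>
    rw [List.nodup_cons] at hnd
    have hQp := hcop p (by simp)
    have hp0 : (0 : ℝ) < (p : ℕ) := by exact_mod_cast p.2.pos
    have hmaps : ((levelSet f G N K B (p :: l) s Q r : Finset ℤ) : Set ℤ).MapsTo (fun x =>
      (⟨padicValInt (p : ℕ) (f.eval x),
        (x % (((p : ℕ) : ℤ) ^ (padicValInt (p : ℕ) (f.eval x) + 1))).toNat⟩ : Σ _ : ℕ, ℕ))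
        ((Finset.range K).sigma fun e => exactResidues f (p : ℕ) e : Finset (Σ _ : ℕ, ℕ)) := by
      intro x hx
      simp only [levelSet, Finset.coe_filter, Set.mem_ofPred_eq, List.forall_mem_cons] at hx
      have hK := hx.2.2.1.1
      rw [padicValInt_dvd_iff] at hK
      push Not at hK
      have h1 := padicValInt_eq_iff.1 ⟨hK.1, (rfl : padicValInt (p : ℕ) (f.eval x) = _)⟩
      exact Finset.mem_sigma.2 ⟨Finset.mem_range.2 hK.2,
        mod_mem_exactResidues p.2.pos h1.1 h1.2⟩
    rw [Finset.card_eq_sum_card_fiberwise hmaps, Finset.sum_sigma, primeSumTrunc]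
    push_cast
    rw [Finset.mul_sum, ← Finset.sum_sub_distrib]
    have hbound : ∀ e ∈ Finset.range K,
        |(∑ ρ ∈ exactResidues f (p : ℕ) e, (((levelSet f G N K B (p :: l) s Q r).filter (fun x =>
          (⟨padicValInt (p : ℕ) (f.eval x),
          (x % (((p : ℕ) : ℤ) ^ (padicValInt (p : ℕ) (f.eval x) + 1))).toNat⟩ : Σ _ : ℕ, ℕ) =
          ⟨e, ρ⟩)).card : ℝ)) - 2 * B * Real.exp (-s) / Q * (residueWeight f p e *
            primeSumTrunc K (residueWeight f) G l (s - e * Real.log (p : ℕ)))| ≤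
        D * (2 * (D * K) ^ l.length) := by
      intro e he
      have hmain : 2 * B * Real.exp (-s) / Q * (residueWeight f p e *
            primeSumTrunc K (residueWeight f) G l (s - e * Real.log (p : ℕ))) =
          ∑ ρ ∈ exactResidues f (p : ℕ) e, 2 * B * Real.exp (-(s - e * Real.log (p : ℕ))) /
            ((Q * (p : ℕ) ^ (e + 1) : ℕ) : ℝ) *
            primeSumTrunc K (residueWeight f) G l (s - e * Real.log (p : ℕ)) := by
        have hexp : Real.exp (-(s - e * Real.log (p : ℕ))) =
            Real.exp (-s) * ((p : ℕ) : ℝ) ^ e := by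
          rw [neg_sub, sub_eq_neg_add, Real.exp_add, Real.exp_nat_mul, Real.exp_log hp0]
        rw [Finset.sum_const, nsmul_eq_mul, residueWeight, hexp]
        push_cast
        field_simp
        ring
      rw [hmain, ← Finset.sum_sub_distrib]
      refine (Finset.abs_sum_le_sum_abs _ _).trans ?_
      refine (Finset.sum_le_card_nsmul _ _ (2 * (D * K) ^ l.length) fun ρ hρ => ?_).trans ?_
      · obtain ⟨r', hr'⟩ := levelSet_fiber (G := G) (N := N) (B := B) (l := l) (s := s) (r := r) hQp
          (Finset.mem_range.1 he) hρ
        rw [hr']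
        refine ih hnd.2 (fun q hq => hD q (by simp [hq])) _
          (Nat.mul_pos hQ (pow_pos p.2.pos _)) (fun q hq => ?_) r' _
        refine Nat.Coprime.mul_left (hcop q (by simp [hq])) (Nat.Coprime.pow_left _ ?_)
        refine (Nat.coprime_primes p.2 q.2).2 fun h => hnd.1 ?_
        rwa [Subtype.ext h]
      · rw [nsmul_eq_mul]
        gcongr
        exact hD p (by simp) e
    refine (Finset.abs_sum_le_sum_abs _ _).trans ((Finset.sum_le_card_nsmul _ _ _ hbound).trans ?_)
    rw [Finset.card_range, nsmul_eq_mul, List.length_cons, pow_succ]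
    exact le_of_eq (by ring)

/-! ### Size of f(x) and truncation of the exponents -/

theorem eventually_eval_near_lead (P : ℝ[X]) {δ : ℝ} (hδ : 0 < δ) :
    ∀ᶠ x : ℝ in atTop, |P.eval x - P.leadingCoeff * x ^ P.natDegree| ≤
      δ * (|P.leadingCoeff| * x ^ P.natDegree) := by
  filter_upwards [P.isEquivalent_atTop_lead.isLittleO.def hδ, eventually_ge_atTop 0] with x hx h0
  simpa [abs_of_nonneg h0] using hx

theorem exists_abs_eval_near_lead (f : ℤ[X]) {δ : ℝ} (hδ : 0 < δ) :
    ∃ x₀ : ℝ, ∀ x : ℤ, x₀ ≤ |(x : ℝ)| →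
      |(|((f.eval x : ℤ) : ℝ)| - |(f.leadingCoeff : ℝ)| * |(x : ℝ)| ^ f.natDegree)| ≤
        δ * (|(f.leadingCoeff : ℝ)| * |(x : ℝ)| ^ f.natDegree) := by
  set P := f.map (Int.castRingHom ℝ)
  have hinj : Function.Injective (Int.castRingHom ℝ) := RingHom.injective_int _
  have hdeg : P.natDegree = f.natDegree := natDegree_map_eq_of_injective hinj f
  have hlead : P.leadingCoeff = f.leadingCoeff := by
    simp [P, leadingCoeff_map_of_injective hinj]
  have hcomp : (P.comp (-X)).natDegree = f.natDegree := by simp [natDegree_comp, hdeg]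
  have hcompl : |(P.comp (-X)).leadingCoeff| = |(f.leadingCoeff : ℝ)| := by
    rw [leadingCoeff_comp (by simp), hlead]
    simp
  have hev : ∀ x : ℤ, P.eval (x : ℝ) = ((f.eval x : ℤ) : ℝ) := fun x => by
    simp [P]
  obtain ⟨y, hy⟩ := eventually_atTop.1 (eventually_eval_near_lead P hδ)
  obtain ⟨z, hz⟩ := eventually_atTop.1 (eventually_eval_near_lead (P.comp (-X)) hδ)
  refine ⟨max y z, fun x hx => ?_⟩
  rcases le_total 0 (x : ℝ) with h | h
  · have h1 := hy x (by rw [← abs_of_nonneg h]; exact (le_max_left _ _).trans hx)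
    rw [hev, hlead, hdeg] at h1
    rw [abs_of_nonneg h]
    refine le_trans ?_ h1
    have := abs_abs_sub_abs_le ((f.eval x : ℤ) : ℝ) (f.leadingCoeff * (x : ℝ) ^ f.natDegree)
    rwa [abs_mul, abs_of_nonneg (pow_nonneg h _)] at this
  · have h1 := hz (-x) (by rw [← abs_of_nonpos h]; exact (le_max_right _ _).trans hx)
    rw [hcomp, hcompl] at h1
    rw [abs_of_nonpos h]
    refine le_trans ?_ h1
    have := abs_abs_sub_abs_le ((f.eval x : ℤ) : ℝ)
      ((P.comp (-X)).leadingCoeff * (-(x : ℝ)) ^ f.natDegree)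
    rw [abs_mul, abs_of_nonneg (pow_nonneg (neg_nonneg.2 h) _), hcompl] at this
    simpa [hev] using this

section

variable {f : ℤ[X]}

theorem exists_mul_pow_le_abs_eval (hf : f ≠ 0) {b : ℝ} (hb : b < |(f.leadingCoeff : ℝ)|) :
    ∃ x₀ : ℝ, ∀ x : ℤ, x₀ ≤ |(x : ℝ)| → b * |(x : ℝ)| ^ f.natDegree ≤ |((f.eval x : ℤ) : ℝ)| := by
  have ha : 0 < |(f.leadingCoeff : ℝ)| := by simpa using hf
  obtain ⟨x₀, h⟩ := exists_abs_eval_near_lead f (δ := (|(f.leadingCoeff : ℝ)| - b) /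
    |(f.leadingCoeff : ℝ)|) (div_pos (sub_pos.2 hb) ha)
  refine ⟨x₀, fun x hx => ?_⟩
  have h1 := (abs_le.1 (h x hx)).1
  rw [← mul_assoc, div_mul_cancel₀ _ ha.ne'] at h1
  linarith

theorem exists_abs_eval_le_mul_pow (hf : f ≠ 0) {b : ℝ} (hb : |(f.leadingCoeff : ℝ)| < b) :
    ∃ x₀ : ℝ, ∀ x : ℤ, x₀ ≤ |(x : ℝ)| → |((f.eval x : ℤ) : ℝ)| ≤ b * |(x : ℝ)| ^ f.natDegree := by
  have ha : 0 < |(f.leadingCoeff : ℝ)| := by simpa using hf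
  obtain ⟨x₀, h⟩ := exists_abs_eval_near_lead f (δ := (b - |(f.leadingCoeff : ℝ)|) /
    |(f.leadingCoeff : ℝ)|) (div_pos (sub_pos.2 hb) ha)
  refine ⟨x₀, fun x hx => ?_⟩
  have h1 := (abs_le.1 (h x hx)).2
  rw [← mul_assoc, div_mul_cancel₀ _ ha.ne'] at h1
  linarith

theorem exists_forall_abs_eval_le (f : ℤ[X]) :
    ∃ C : ℝ, 0 < C ∧ ∀ (B : ℝ), 1 ≤ B → ∀ x : ℤ, |(x : ℝ)| ≤ B →
      |((f.eval x : ℤ) : ℝ)| ≤ C * B ^ f.natDegree := by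
  refine ⟨(∑ i ∈ Finset.range (f.natDegree + 1), |(f.coeff i : ℝ)|) + 1, by positivity,
    fun B hB x hx => ?_⟩
  rw [eval_eq_sum_range]
  push_cast
  have hBn : 0 ≤ B ^ f.natDegree := by positivity
  calc _ ≤ ∑ i ∈ Finset.range (f.natDegree + 1), |(f.coeff i : ℝ) * (x : ℝ) ^ i| :=
        Finset.abs_sum_le_sum_abs _ _
    _ ≤ ∑ i ∈ Finset.range (f.natDegree + 1), |(f.coeff i : ℝ)| * B ^ f.natDegree := by
        refine Finset.sum_le_sum fun i hi => ?_
        rw [abs_mul, abs_pow]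
        gcongr
        exact (pow_le_pow_left₀ (abs_nonneg _) hx i).trans
          (pow_le_pow_right₀ hB (Nat.lt_succ_iff.1 (Finset.mem_range.1 hi)))
    _ ≤ _ := by rw [← Finset.sum_mul]; gcongr; linarith

/-- A number of exponents sufficient to describe all `x` with `|x| ≤ B`. -/
def truncLevel (n : ℕ) (B : ℝ) : ℕ := ⌈4 * n * Real.log B⌉₊

/-- The factor 4 in `truncLevel` suffices because `log 2 > 1/2`. The exponent `2 * n` leaves room to
beat `|f(x)| = O(B^n)`, and it also makes the tail of the sum over exponents bounded. -/
theorem pow_le_two_pow_truncLevel {n : ℕ} {B : ℝ} (hB : 1 ≤ B) :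
    B ^ (2 * n) ≤ 2 ^ truncLevel n B := by
  have hB0 : 0 < B := zero_lt_one.trans_le hB
  have hlog := Real.log_nonneg hB
  rw [← Real.log_le_log_iff (by positivity) (by positivity), Real.log_pow, Real.log_pow]
  have h1 : 4 * n * Real.log B ≤ truncLevel n B := Nat.le_ceil _
  have h2 := Real.log_two_gt_d9
  have h3 : 0 ≤ (n : ℝ) * Real.log B := by positivity
  push_cast
  nlinarith

theorem eventually_not_pow_truncLevel_dvd (hn : 1 ≤ f.natDegree) :
    ∀ᶠ B : ℝ in atTop, ∀ x : ℤ, |(x : ℝ)| ≤ B → f.eval x ≠ 0 → ∀ p : Nat.Primes,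
      ¬ ((p : ℕ) : ℤ) ^ truncLevel f.natDegree B ∣ f.eval x := by
  obtain ⟨C, hC, h⟩ := exists_forall_abs_eval_le f
  have h1 : Tendsto (fun B : ℝ => B ^ f.natDegree) atTop atTop := tendsto_pow_atTop (by omega)
  filter_upwards [eventually_ge_atTop 1, h1.eventually_gt_atTop C] with B hB1 hBC x hx hx0 p hdvd
  have h2 := h B hB1 x hx
  have h3 := Int.le_of_dvd (abs_pos.2 hx0) ((dvd_abs _ _).2 hdvd)
  have h4 : (((p : ℕ) : ℝ)) ^ truncLevel f.natDegree B ≤ |((f.eval x : ℤ) : ℝ)| := by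
    exact_mod_cast h3
  have h5 : (2 : ℝ) ^ truncLevel f.natDegree B ≤ ((p : ℕ) : ℝ) ^ truncLevel f.natDegree B := by
    gcongr; exact_mod_cast p.2.two_le
  have h6 := pow_le_two_pow_truncLevel (n := f.natDegree) hB1
  have h7 : C * B ^ f.natDegree < B ^ (2 * f.natDegree) := by
    rw [two_mul, pow_add]
    have : 0 < B ^ f.natDegree := by positivity
    gcongr
  linarith

theorem truncLevel_pow_isLittleO (n k : ℕ) (D : ℝ) {θ : ℝ} (hθ : 0 < θ) :
    (fun B : ℝ => (D * truncLevel n B) ^ k) =o[atTop] fun B => B ^ θ := by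
  have h1 : (fun B : ℝ => D * (truncLevel n B : ℝ)) =O[atTop] Real.log := by
    refine IsBigO.of_bound (|D| * (4 * n + 1)) ?_
    filter_upwards [eventually_ge_atTop (Real.exp 1)] with B hB
    have hlog : 1 ≤ Real.log B := by
      rw [← Real.log_exp 1]
      exact Real.log_le_log (Real.exp_pos _) hB
    have h2 : (truncLevel n B : ℝ) ≤ 4 * n * Real.log B + 1 :=
      (Nat.ceil_lt_add_one (by positivity)).le
    rw [norm_mul, Real.norm_eq_abs, mul_assoc, Real.norm_of_nonneg (Nat.cast_nonneg _),
      Real.norm_of_nonneg (by linarith)]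
    gcongr
    linarith
  refine (h1.pow k).trans_isLittleO ?_
  have h3 := isLittleO_log_rpow_rpow_atTop (k : ℝ) hθ
  simpa using h3

theorem sPart_eq_listPart {S : Finset Nat.Primes} {l : List Nat.Primes} (hnd : l.Nodup)
    (hl : l.toFinset = S) (f : ℤ[X]) (x : ℤ) : (sPart S (f.eval x) : ℝ) = listPart f l x := by
  rw [sPart, ← hl, List.prod_toFinset _ hnd, listPart]
  push_cast
  simp [Function.comp_def]

/-- This identity dictates the shape of `profile`: the branch `e^T` produces the cutoff `B`, the
other branch the cutoff imposed by the `S`-part. -/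
theorem size_eq_min {ν B c u : ℝ} (hν : 0 < ν) (hB : 0 < B) (hc : 0 < c) (hu : 0 < u) :
    B * Real.exp (-(ν * Real.log (B / c))) * u *
      profile ν⁻¹ (ν * Real.log (B / c) - Real.log u) = min B (c * u ^ ν⁻¹) := by
  set T := ν * Real.log (B / c) with hT
  have hpos : 0 ≤ B * Real.exp (-T) * u := by positivity
  have hBexp : B * Real.exp (-(ν⁻¹ * T)) = c := by
    rw [hT, inv_mul_cancel_left₀ hν.ne', Real.exp_neg, Real.exp_log (by positivity)]
    field_simp
  rw [profile, mul_min_of_nonneg _ _ hpos]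
  congr 1
  · rw [mul_assoc, mul_assoc]
    conv_lhs => rw [← Real.exp_log hu]
    rw [Real.log_exp, ← Real.exp_add, ← Real.exp_add]
    simp
  · rw [Real.rpow_def_of_pos hu, ← hBexp]
    rw [mul_assoc, mul_assoc, mul_assoc]
    conv_lhs => rw [← Real.exp_log hu]
    rw [Real.log_exp, ← Real.exp_add, ← Real.exp_add, ← Real.exp_add]
    congr 2
    ring

theorem main_term_eq {ν B c : ℝ} (hB : 0 < B) (hc : 0 < c) :
    B * Real.exp (-(ν * Real.log (B / c))) = c ^ ν * B ^ (1 - ν) := by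
  rw [Real.log_div hB.ne' hc.ne', Real.rpow_def_of_pos hB, Real.rpow_def_of_pos hc]
  conv_lhs => rw [← Real.exp_log hB]
  rw [Real.log_exp, ← Real.exp_add, ← Real.exp_add]
  congr 1
  ring

end

/-! ### Comparison of the counting function with level sets -/

section

variable {f : ℤ[X]} {S : Finset Nat.Primes} {l : List Nat.Primes} {ε : ℝ}

/-- The strict inequality on `c` absorbs the relative error in `|f(x)| ~ |a||x|^n`, `a` being the
leading coefficient. The converse implication needs the opposite inequality, which is why upper and
lower bounds for `countN` use different constants. -/
theorem exists_abs_le_of_abs_eval_rpow_le (hf : f ≠ 0) (hε : 0 < ε) (hn : 1 ≤ f.natDegree) {c : ℝ}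
    (hc : 0 < c) (hca : (c ^ f.natDegree)⁻¹ < |(f.leadingCoeff : ℝ)|) :
    ∃ x₀ : ℝ, ∀ x : ℤ, x₀ ≤ |(x : ℝ)| → ∀ u : ℝ, |((f.eval x : ℤ) : ℝ)| ^ ε ≤ u →
      |(x : ℝ)| ≤ c * u ^ (f.natDegree * ε)⁻¹ := by
  obtain ⟨x₀, h⟩ := exists_mul_pow_le_abs_eval hf hca
  refine ⟨x₀, fun x hx u hu => ?_⟩
  have h1 := h x hx
  have hn0 : (0 : ℝ) < f.natDegree := by exact_mod_cast hn
  set y := |(x : ℝ)|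
  have hy : 0 ≤ y := abs_nonneg _
  have h2 : (y / c) ^ f.natDegree ≤ |((f.eval x : ℤ) : ℝ)| := by
    rw [div_pow]; rwa [inv_mul_eq_div] at h1
  have hyc : 0 ≤ y / c := by positivity
  have h3 : (y / c) ^ (f.natDegree * ε) ≤ u := by
    rw [Real.rpow_mul hyc, Real.rpow_natCast]
    exact (Real.rpow_le_rpow (by positivity) h2 hε.le).trans hu
  have h4 : y / c ≤ u ^ (f.natDegree * ε)⁻¹ := by
    have := Real.rpow_le_rpow (by positivity) h3 (inv_nonneg.2 (mul_pos hn0 hε).le)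
    rwa [Real.rpow_rpow_inv hyc (mul_pos hn0 hε).ne'] at this
  rwa [div_le_iff₀' hc] at h4

theorem exists_abs_eval_rpow_le_of_abs_le (hf : f ≠ 0) (hε : 0 < ε) (hn : 1 ≤ f.natDegree) {c : ℝ}
    (hc : 0 < c) (hca : |(f.leadingCoeff : ℝ)| < (c ^ f.natDegree)⁻¹) :
    ∃ x₀ : ℝ, ∀ x : ℤ, x₀ ≤ |(x : ℝ)| → ∀ u : ℝ, 0 < u →
      |(x : ℝ)| ≤ c * u ^ (f.natDegree * ε)⁻¹ → |((f.eval x : ℤ) : ℝ)| ^ ε ≤ u := by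
  obtain ⟨x₀, h⟩ := exists_abs_eval_le_mul_pow hf hca
  refine ⟨x₀, fun x hx u hu hxu => ?_⟩
  have h1 := h x hx
  have hn0 : (0 : ℝ) < f.natDegree := by exact_mod_cast hn
  set y := |(x : ℝ)|
  have hy : 0 ≤ y := abs_nonneg _
  have hyc : 0 ≤ y / c := by positivity
  have h2 : |((f.eval x : ℤ) : ℝ)| ≤ (y / c) ^ f.natDegree := by
    rw [div_pow]; rwa [inv_mul_eq_div] at h1
  calc |((f.eval x : ℤ) : ℝ)| ^ ε ≤ ((y / c) ^ f.natDegree) ^ ε :=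
        Real.rpow_le_rpow (abs_nonneg _) h2 hε.le
    _ = (y / c) ^ (f.natDegree * ε) := by rw [Real.rpow_mul hyc, Real.rpow_natCast]
    _ ≤ (u ^ (f.natDegree * ε)⁻¹) ^ (f.natDegree * ε) :=
        Real.rpow_le_rpow hyc ((div_le_iff₀' hc).2 hxu) (mul_pos hn0 hε).le
    _ = u := Real.rpow_inv_rpow hu.le (mul_pos hn0 hε).ne'

theorem exists_eval_ne_zero_of_le_abs (hf : f ≠ 0) :
    ∃ x₀ : ℝ, ∀ x : ℤ, x₀ ≤ |(x : ℝ)| → f.eval x ≠ 0 := by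
  have ha : 0 < |(f.leadingCoeff : ℝ)| := by simpa using hf
  obtain ⟨x₀, h⟩ := exists_mul_pow_le_abs_eval hf (half_lt_self ha)
  refine ⟨max x₀ 1, fun x hx h0 => ?_⟩
  have h1 := h x ((le_max_left _ _).trans hx)
  have h2 : 0 < |(x : ℝ)| := zero_lt_one.trans_le ((le_max_right _ _).trans hx)
  rw [h0, Int.cast_zero, abs_zero] at h1
  have : 0 < |(f.leadingCoeff : ℝ)| / 2 * |(x : ℝ)| ^ f.natDegree := by positivity
  linarith

/-- The set counted by `countN`. -/
def countSet (f : ℤ[X]) (S : Finset Nat.Primes) (ε B : ℝ) : Set ℤ :=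
  {x : ℤ | |(x : ℝ)| ≤ B ∧ 0 < |((f.eval x : ℤ) : ℝ)| ^ ε ∧
    |((f.eval x : ℤ) : ℝ)| ^ ε ≤ (sPart S (f.eval x) : ℝ)}

theorem countSet_subset_Icc (f : ℤ[X]) (S : Finset Nat.Primes) (ε B : ℝ) :
    countSet f S ε B ⊆ (Finset.Icc (-⌊B⌋) ⌊B⌋ : Finset ℤ) := by
  intro x hx
  have h : |x| ≤ ⌊B⌋ := by rw [Int.le_floor]; push_cast; exact hx.1
  rw [Finset.coe_Icc]
  exact abs_le.1 h

theorem eval_ne_zero_of_rpow_pos (hε : 0 < ε) {y : ℤ} (h : 0 < |(y : ℝ)| ^ ε) : y ≠ 0 := by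
  rintro rfl
  simp [Real.zero_rpow hε.ne'] at h

/-- The relevant level set with trivial congruence condition. -/
def mainLevelSet (f : ℤ[X]) (l : List Nat.Primes) (ν c B : ℝ) : Finset ℤ :=
  levelSet f (profile ν⁻¹) ⌈B⌉ (truncLevel f.natDegree B) B l (ν * Real.log (B / c)) 1 0

theorem mem_mainLevelSet {ν c B : ℝ} (hν : 0 < ν) (hB : 0 < B) (hc : 0 < c) (x : ℤ) :
    x ∈ mainLevelSet f l ν c B ↔
      (∀ p ∈ l, ¬ ((p : ℕ) : ℤ) ^ truncLevel f.natDegree B ∣ f.eval x) ∧ |(x : ℝ)| ≤ B ∧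
        |(x : ℝ)| ≤ c * listPart f l x ^ ν⁻¹ := by
  rw [mainLevelSet, levelSet, Finset.mem_filter, size_eq_min hν hB hc (listPart_pos f l x), le_min_iff]
  constructor
  · rintro ⟨-, -, h1, h2⟩
    exact ⟨h1, h2⟩
  · rintro ⟨h1, h2⟩
    refine ⟨?_, ?_, h1, h2⟩
    · rw [Finset.mem_Icc, ← abs_le]
      have : |(x : ℝ)| ≤ ⌈B⌉ := h2.1.trans (Int.le_ceil B)
      exact_mod_cast this
    · simpa using Int.modEq_one

theorem exists_countN_le_card (hf : f ≠ 0) (hε : 0 < ε) (hn : 1 ≤ f.natDegree) (hnd : l.Nodup)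
    (hl : l.toFinset = S) {c : ℝ} (hc : 0 < c)
    (hca : (c ^ f.natDegree)⁻¹ < |(f.leadingCoeff : ℝ)|) :
    ∃ M : ℝ, ∀ᶠ B : ℝ in atTop,
      (countN f S ε B : ℝ) ≤ (mainLevelSet f l (f.natDegree * ε) c B).card + M := by
  obtain ⟨x₀, h⟩ := exists_abs_le_of_abs_eval_rpow_le hf hε hn hc hca
  refine ⟨(Finset.Icc (-⌈x₀⌉) ⌈x₀⌉).card, ?_⟩
  have hn0 : (0 : ℝ) < f.natDegree := by exact_mod_cast hn
  filter_upwards [eventually_gt_atTop 0, eventually_not_pow_truncLevel_dvd hn] with B hB hK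
  have hsub : countSet f S ε B ⊆
      (mainLevelSet f l (f.natDegree * ε) c B ∪ Finset.Icc (-⌈x₀⌉) ⌈x₀⌉ : Finset ℤ) := by
    intro x hx
    rw [Finset.coe_union]
    by_cases hx₀ : x₀ ≤ |(x : ℝ)|
    · left
      rw [Finset.mem_coe, mem_mainLevelSet (mul_pos hn0 hε) hB hc]
      refine ⟨fun p _ => hK x hx.1 (eval_ne_zero_of_rpow_pos hε hx.2.1) p, hx.1, ?_⟩
      exact h x hx₀ _ (by rw [← sPart_eq_listPart hnd hl]; exact hx.2.2)
    · right
      rw [Finset.mem_coe, Finset.mem_Icc, ← abs_le]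
      have : |(x : ℝ)| ≤ ⌈x₀⌉ := (not_le.1 hx₀).le.trans (Int.le_ceil _)
      exact_mod_cast this
  have h1 := Set.ncard_le_ncard hsub (Finset.finite_toSet _)
  rw [Set.ncard_coe_finset] at h1
  exact_mod_cast h1.trans (Finset.card_union_le _ _)

theorem exists_card_le_countN (hf : f ≠ 0) (hε : 0 < ε) (hn : 1 ≤ f.natDegree) (hnd : l.Nodup)
    (hl : l.toFinset = S) {c : ℝ} (hc : 0 < c)
    (hca : |(f.leadingCoeff : ℝ)| < (c ^ f.natDegree)⁻¹) :
    ∃ M : ℝ, ∀ᶠ B : ℝ in atTop,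
      ((mainLevelSet f l (f.natDegree * ε) c B).card : ℝ) ≤ countN f S ε B + M := by
  obtain ⟨x₁, h⟩ := exists_abs_eval_rpow_le_of_abs_le hf hε hn hc hca
  obtain ⟨x₂, h'⟩ := exists_eval_ne_zero_of_le_abs hf
  set x₀ := max x₁ x₂
  refine ⟨(Finset.Icc (-⌈x₀⌉) ⌈x₀⌉).card, ?_⟩
  have hn0 : (0 : ℝ) < f.natDegree := by exact_mod_cast hn
  filter_upwards [eventually_gt_atTop 0] with B hB
  have hsub : ((mainLevelSet f l (f.natDegree * ε) c B : Finset ℤ) : Set ℤ) ⊆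
      countSet f S ε B ∪ (Finset.Icc (-⌈x₀⌉) ⌈x₀⌉ : Finset ℤ) := by
    intro x hx
    rw [Finset.mem_coe, mem_mainLevelSet (mul_pos hn0 hε) hB hc] at hx
    by_cases hx₀ : x₀ ≤ |(x : ℝ)|
    · left
      refine ⟨hx.2.1, Real.rpow_pos_of_pos (abs_pos.2 ?_) _, ?_⟩
      · exact_mod_cast h' x ((le_max_right _ _).trans hx₀)
      · rw [sPart_eq_listPart hnd hl]
        exact h x ((le_max_left _ _).trans hx₀) _ (listPart_pos f l x) hx.2.2
    · right
      rw [Finset.mem_coe, Finset.mem_Icc, ← abs_le]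
      have : |(x : ℝ)| ≤ ⌈x₀⌉ := (not_le.1 hx₀).le.trans (Int.le_ceil _)
      exact_mod_cast this
  have h1 := Set.ncard_le_ncard hsub
    (((Finset.finite_toSet _).subset (countSet_subset_Icc f S ε B)).union (Finset.finite_toSet _))
  have h2 := h1.trans (Set.ncard_union_le _ _)
  rw [Set.ncard_coe_finset, Set.ncard_coe_finset] at h2
  exact_mod_cast h2

/-- The class-by-class error is a power of `log B`. Passing from the truncated to the full sum costs
at most `2 * A'`, since the tail is `O(e^T 2^(-K))` with `2^K ≥ B`. -/
theorem exists_abs_card_mainLevelSet_sub_le (hn : 1 ≤ f.natDegree) (hnd : l.Nodup)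
    {w : Nat.Primes → ℝ} (hw : ∀ p ∈ l, IsWeight (residueWeight f p) (w p)) {ν c : ℝ}
    (hν1 : ν < 1) (hc : 0 < c) :
    ∃ E : ℝ → ℝ, E =o[atTop] (fun B : ℝ => B ^ (1 - ν)) ∧ ∀ᶠ B : ℝ in atTop,
      |((mainLevelSet f l ν c B).card : ℝ) - 2 * c ^ ν * B ^ (1 - ν) *
        primeSum (residueWeight f) (profile ν⁻¹) l (ν * Real.log (B / c))| ≤ E B := by
  have hD : ∃ D : ℝ, 0 ≤ D ∧ ∀ p ∈ l, ∀ e, ((exactResidues f (p : ℕ) e).card : ℝ) ≤ D := by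
    clear hnd
    induction l with
    | nil => exact ⟨0, le_rfl, by simp⟩
    | cons p l ih =>
      obtain ⟨D, hD0, hD⟩ := ih fun q hq => hw q (by simp [hq])
      obtain ⟨D', hD0', hD'⟩ := (hw p (by simp)).exists_bound
      have hp0 : (0 : ℝ) < (p : ℕ) := by exact_mod_cast p.2.pos
      refine ⟨D + D' * (p : ℕ), by positivity, ?_⟩
      rw [List.forall_mem_cons]
      refine ⟨fun e => ?_, fun q hq e => (hD q hq e).trans (by have := mul_pos hD0' hp0; linarith)⟩
      have := (le_abs_self _).trans (hD' e)
      rw [residueWeight, div_le_iff₀ hp0] at this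
      linarith
  obtain ⟨D, hD0, hD⟩ := hD
  have hG0 : ∀ T, 0 ≤ profile ν⁻¹ T := fun T => (profile_pos _ T).le
  obtain ⟨A', hA', hdiff⟩ := exists_primeSum_sub_trunc_le (abs_profile_le_exp ν⁻¹) l hw
  have hθ : 0 < 1 - ν := by linarith
  refine ⟨fun B => 2 * (D * truncLevel f.natDegree B) ^ l.length + 2 * A',
    ((truncLevel_pow_isLittleO f.natDegree l.length D hθ).const_mul_left 2).add
    (isLittleO_const_left.2 (Or.inr ?_)), ?_⟩
  · exact tendsto_norm_atTop_atTop.comp (tendsto_rpow_atTop hθ)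
  · filter_upwards [eventually_ge_atTop 1] with B hB1
    have hB : 0 < B := zero_lt_one.trans_le hB1
    set T := ν * Real.log (B / c) with hT
    set K := truncLevel f.natDegree B
    have h1 := abs_card_levelSet_sub_le hG0 (fun T => (le_abs_self _).trans
      ((abs_profile_le_exp ν⁻¹ T).trans_eq (one_mul _))) hB.le (Int.le_ceil B) hD0 K l hnd hD 1
      one_pos (fun _ _ => Nat.coprime_one_left _) 0 T
    have h2 := main_term_eq (ν := ν) hB hc
    rw [← hT] at h2
    have h3 : 2 * B * Real.exp (-T) / ((1 : ℕ) : ℝ) = 2 * c ^ ν * B ^ (1 - ν) := by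
      rw [Nat.cast_one, div_one, mul_assoc, h2, mul_assoc]
    rw [h3] at h1
    have h4 := hdiff K T
    have h5 := primeSumTrunc_le (abs_profile_le_exp ν⁻¹) hG0 l hw K T
    have h6 : |2 * c ^ ν * B ^ (1 - ν) * primeSumTrunc K (residueWeight f) (profile ν⁻¹) l T -
        2 * c ^ ν * B ^ (1 - ν) * primeSum (residueWeight f) (profile ν⁻¹) l T| ≤ 2 * A' := by
      rw [← mul_sub, abs_mul, abs_of_pos (by positivity), abs_sub_comm,
        abs_of_nonneg (sub_nonneg.2 h5), ← h3, Nat.cast_one, div_one]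
      have h7 := pow_le_two_pow_truncLevel (n := f.natDegree) hB1
      have h8 : B ≤ 2 ^ K := (le_self_pow₀ hB1 (by omega)).trans h7
      have h9 : Real.exp (-T) * Real.exp T = 1 := by rw [← Real.exp_add]; simp
      calc _ ≤ 2 * B * Real.exp (-T) * (A' * Real.exp T * (1 / 2) ^ K) := by gcongr
        _ = 2 * A' * (B * (1 / 2) ^ K) * (Real.exp (-T) * Real.exp T) := by ring
        _ ≤ 2 * A' * 1 * 1 := by
            rw [h9]
            gcongr
            rw [one_div, inv_pow, ← div_eq_mul_inv]
            exact div_le_one_of_le₀ h8 (by positivity)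
        _ = 2 * A' := by ring
    exact (abs_sub_le _ _ _).trans (add_le_add h1 h6)

theorem exists_countN_le (hε : 0 < ε) (hn : 1 ≤ f.natDegree) (hnε : f.natDegree * ε < 1)
    (hnd : l.Nodup) (hl : l.toFinset = S) {w : Nat.Primes → ℝ}
    (hw : ∀ p ∈ l, IsWeight (residueWeight f p) (w p)) {c : ℝ} (hc : 0 < c)
    (hca : (c ^ f.natDegree)⁻¹ < |(f.leadingCoeff : ℝ)|) :
    ∃ E : ℝ → ℝ, E =o[atTop] (fun B : ℝ => B ^ (1 - f.natDegree * ε)) ∧ ∀ᶠ B : ℝ in atTop,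
      (countN f S ε B : ℝ) ≤ 2 * c ^ (f.natDegree * ε) * B ^ (1 - f.natDegree * ε) *
        primeSum (residueWeight f) (profile (f.natDegree * ε)⁻¹) l
          (f.natDegree * ε * Real.log (B / c)) + E B := by
  have hf : f ≠ 0 := by rintro rfl; simp at hn
  obtain ⟨M, hM⟩ := exists_countN_le_card hf hε hn hnd hl hc hca
  obtain ⟨E, hE, h⟩ := exists_abs_card_mainLevelSet_sub_le hn hnd hw hnε hc
  refine ⟨fun B => E B + M, hE.add (isLittleO_const_left.2 (Or.inr
    (tendsto_norm_atTop_atTop.comp (tendsto_rpow_atTop (by linarith))))), ?_⟩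
  filter_upwards [hM, h] with B h1 h2
  linarith [(abs_le.1 h2).2]

theorem exists_le_countN (hε : 0 < ε) (hn : 1 ≤ f.natDegree) (hnε : f.natDegree * ε < 1)
    (hnd : l.Nodup) (hl : l.toFinset = S) {w : Nat.Primes → ℝ}
    (hw : ∀ p ∈ l, IsWeight (residueWeight f p) (w p)) {c : ℝ} (hc : 0 < c)
    (hca : |(f.leadingCoeff : ℝ)| < (c ^ f.natDegree)⁻¹) :
    ∃ E : ℝ → ℝ, E =o[atTop] (fun B : ℝ => B ^ (1 - f.natDegree * ε)) ∧ ∀ᶠ B : ℝ in atTop,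
      2 * c ^ (f.natDegree * ε) * B ^ (1 - f.natDegree * ε) *
        primeSum (residueWeight f) (profile (f.natDegree * ε)⁻¹) l
          (f.natDegree * ε * Real.log (B / c)) - E B ≤ countN f S ε B := by
  have hf : f ≠ 0 := by rintro rfl; simp at hn
  obtain ⟨M, hM⟩ := exists_card_le_countN hf hε hn hnd hl hc hca
  obtain ⟨E, hE, h⟩ := exists_abs_card_mainLevelSet_sub_le hn hnd hw hnε hc
  refine ⟨fun B => E B + M, hE.add (isLittleO_const_left.2 (Or.inr
    (tendsto_norm_atTop_atTop.comp (tendsto_rpow_atTop (by linarith))))), ?_⟩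
  filter_upwards [hM, h] with B h1 h2
  linarith [(abs_le.1 h2).1]

end

/-! ### Asymptotics and two-sided bounds for the counting function -/

theorem tendsto_of_forall_sandwich {u φ : ℝ → ℝ} {c₀ : ℝ} (hc₀ : 0 < c₀) (hφ : ContinuousAt φ c₀)
    (hup : ∀ c, c₀ < c → ∃ v : ℝ → ℝ, Tendsto v atTop (𝓝 (φ c)) ∧ ∀ᶠ B in atTop, u B ≤ v B)
    (hlow : ∀ c, 0 < c → c < c₀ → ∃ v : ℝ → ℝ, Tendsto v atTop (𝓝 (φ c)) ∧
      ∀ᶠ B in atTop, v B ≤ u B) : Tendsto u atTop (𝓝 (φ c₀)) := by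
  refine tendsto_order.2 ⟨fun y hy => ?_, fun y hy => ?_⟩
  · have h1 : ∀ᶠ c in 𝓝[<] c₀, y < φ c := (hφ.eventually_const_lt hy).filter_mono nhdsWithin_le_nhds
    have h2 : ∀ᶠ c in 𝓝[<] c₀, 0 < c :=
      (eventually_gt_nhds hc₀).filter_mono nhdsWithin_le_nhds
    obtain ⟨c, ⟨hc1, hc2⟩, hc3⟩ := ((h1.and h2).and self_mem_nhdsWithin).exists
    obtain ⟨v, hv, hvu⟩ := hlow c hc2 hc3
    filter_upwards [hv.eventually_const_lt hc1, hvu] with B h3 h4 using h3.trans_le h4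
  · have h1 : ∀ᶠ c in 𝓝[>] c₀, φ c < y := (hφ.eventually_lt_const hy).filter_mono nhdsWithin_le_nhds
    obtain ⟨c, hc1, hc3⟩ := (h1.and self_mem_nhdsWithin).exists
    obtain ⟨v, hv, hvu⟩ := hup c hc3
    filter_upwards [hv.eventually_lt_const hc1, hvu] with B h3 h4 using h4.trans_lt h3

theorem tendsto_mul_log_div_atTop {ν c : ℝ} (hν : 0 < ν) (hc : 0 < c) :
    Tendsto (fun B : ℝ => ν * Real.log (B / c)) atTop atTop :=
  (Real.tendsto_log_atTop.comp (tendsto_id.atTop_div_const hc)).const_mul_atTop hν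

theorem tendsto_main_term {H E : ℝ → ℝ} {ν c C : ℝ} {d : ℕ} (hν : 0 < ν) (hc : 0 < c)
    (hH : Tendsto (fun T => H T / T ^ d) atTop (𝓝 C))
    (hE : E =o[atTop] fun B : ℝ => B ^ (1 - ν)) :
    Tendsto (fun B : ℝ => (2 * c ^ ν * B ^ (1 - ν) * H (ν * Real.log (B / c)) + E B) /
      (B ^ (1 - ν) * Real.log B ^ d)) atTop (𝓝 (2 * c ^ ν * (C * ν ^ d))) := by
  have hT := tendsto_mul_log_div_atTop hν hc
  have h1 : Tendsto (fun B : ℝ => ν * Real.log (B / c) / Real.log B) atTop (𝓝 (ν * 1)) := by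
    refine (((tendsto_sub_const_div_atTop (Real.log c)).comp Real.tendsto_log_atTop).const_mul
      ν).congr' ?_
    filter_upwards [eventually_gt_atTop 0] with B hB
    rw [Function.comp, Real.log_div hB.ne' hc.ne', mul_div_assoc]
  rw [mul_one] at h1
  have h2 := ((hH.comp hT).mul (h1.pow d)).const_mul (2 * c ^ ν)
  have h3 : Tendsto (fun B : ℝ => E B / (B ^ (1 - ν) * Real.log B ^ d)) atTop (𝓝 0) := by
    have h4 : Tendsto (fun B : ℝ => E B / B ^ (1 - ν)) atTop (𝓝 0) := hE.tendsto_div_nhds_zero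
    refine squeeze_zero_norm' ?_ (tendsto_zero_iff_norm_tendsto_zero.1 h4)
    filter_upwards [eventually_ge_atTop (Real.exp 1)] with B hB
    have hlog : 1 ≤ Real.log B := by
      rw [← Real.log_exp 1]
      exact Real.log_le_log (Real.exp_pos _) hB
    rw [← div_div, norm_div]
    refine div_le_self (norm_nonneg _) ?_
    rw [norm_pow]
    exact one_le_pow₀ (hlog.trans (le_abs_self _))
  have h5 := h2.add h3
  rw [add_zero] at h5
  refine h5.congr' ?_
  filter_upwards [eventually_gt_atTop 1, hT.eventually_gt_atTop 0] with B hB hTB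
  have hB0 : 0 < B := zero_lt_one.trans hB
  have hlog : 0 < Real.log B := Real.log_pos hB
  have hBθ : 0 < B ^ (1 - ν) := Real.rpow_pos_of_pos hB0 _
  simp only [Function.comp]
  rw [div_pow, add_div]
  congr 1
  have hTd : (ν * Real.log (B / c)) ^ d ≠ 0 := (pow_pos hTB d).ne'
  generalize (ν * Real.log (B / c)) ^ d = y at hTd ⊢
  field_simp

section

variable {f : ℤ[X]} {S : Finset Nat.Primes} {l : List Nat.Primes} {ε : ℝ} {w : Nat.Primes → ℝ}

theorem exists_pos_pow_inv_eq {n : ℕ} (hn : 1 ≤ n) {a : ℝ} (ha : 0 < a) :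
    ∃ c : ℝ, 0 < c ∧ (c ^ n)⁻¹ = a := by
  refine ⟨(a⁻¹) ^ ((n : ℝ)⁻¹), by positivity, ?_⟩
  rw [Real.rpow_inv_natCast_pow (by positivity) (by omega), inv_inv]

theorem countN_isEquivalent (hε : 0 < ε) (hn : 1 ≤ f.natDegree) (hnε : f.natDegree * ε < 1)
    (hnd : l.Nodup) (hl : l.toFinset = S) (hw : ∀ p ∈ l, IsWeight (residueWeight f p) (w p)) {d : ℕ}
    {C : ℝ} (hC : 0 < C) (hH : Tendsto (fun T => primeSum (residueWeight f)
      (profile (f.natDegree * ε)⁻¹) l T / T ^ d) atTop (𝓝 C)) :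
    ∃ C : ℝ, 0 < C ∧ (fun B : ℝ => (countN f S ε B : ℝ)) ~[atTop]
      fun B : ℝ => C * B ^ (1 - f.natDegree * ε) * Real.log B ^ d := by
  have hf : f ≠ 0 := by rintro rfl; simp at hn
  have hν : 0 < f.natDegree * ε := mul_pos (by exact_mod_cast hn) hε
  set ν := f.natDegree * ε
  have ha : 0 < |(f.leadingCoeff : ℝ)| := by simpa using hf
  obtain ⟨c₀, hc₀, hca⟩ := exists_pos_pow_inv_eq hn ha
  have hden : ∀ᶠ B : ℝ in atTop, 0 < B ^ (1 - ν) * Real.log B ^ d := by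
    filter_upwards [eventually_gt_atTop 1] with B hB
    have := Real.log_pos hB
    have : 0 < B := zero_lt_one.trans hB
    positivity
  have hlim : Tendsto (fun B : ℝ => (countN f S ε B : ℝ) / (B ^ (1 - ν) * Real.log B ^ d)) atTop
      (𝓝 (2 * c₀ ^ ν * (C * ν ^ d))) := by
    refine tendsto_of_forall_sandwich (φ := fun c => 2 * c ^ ν * (C * ν ^ d)) hc₀ ?_ ?_ ?_
    · exact ((Real.continuousAt_rpow_const _ _ (Or.inl hc₀.ne')).const_mul _).mul_const _
    · intro c hc
      obtain ⟨E, hE, h⟩ := exists_countN_le hε hn hnε hnd hl hw (hc₀.trans hc) (by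
        rw [← hca]
        exact inv_strictAnti₀ (by positivity) (pow_lt_pow_left₀ hc hc₀.le (by omega)))
      refine ⟨_, tendsto_main_term hν (hc₀.trans hc) hH hE, ?_⟩
      filter_upwards [h, hden] with B h1 h2
      exact div_le_div_of_nonneg_right h1 h2.le
    · intro c hc hcc
      obtain ⟨E, hE, h⟩ := exists_le_countN hε hn hnε hnd hl hw hc (by
        rw [← hca]
        exact inv_strictAnti₀ (by positivity) (pow_lt_pow_left₀ hcc hc.le (by omega)))
      refine ⟨_, tendsto_main_term hν hc hH hE.neg_left, ?_⟩
      filter_upwards [h, hden] with B h1 h2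
      exact div_le_div_of_nonneg_right h1 h2.le
  have hL : 0 < 2 * c₀ ^ ν * (C * ν ^ d) := by positivity
  refine ⟨_, hL, isEquivalent_of_tendsto_one ?_⟩
  have h1 := hlim.div_const (2 * c₀ ^ ν * (C * ν ^ d))
  rw [div_self hL.ne'] at h1
  refine h1.congr fun B => ?_
  rw [Pi.div_apply, div_div]
  congr 1
  ring

theorem exists_bounds_countN (hε : 0 < ε) (hn : 1 ≤ f.natDegree) (hnε : f.natDegree * ε < 1)
    (hnd : l.Nodup) (hl : l.toFinset = S) (hw : ∀ p ∈ l, IsWeight (residueWeight f p) (w p))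
    {ψ A : ℝ} (hψ : 0 < ψ) (hH : ∀ᶠ T in atTop,
      ψ ≤ primeSum (residueWeight f) (profile (f.natDegree * ε)⁻¹) l T ∧
        primeSum (residueWeight f) (profile (f.natDegree * ε)⁻¹) l T ≤ A) :
    ∃ k K : ℝ, 0 < k ∧ ∀ᶠ B : ℝ in atTop, k * B ^ (1 - f.natDegree * ε) ≤ countN f S ε B ∧
      countN f S ε B ≤ K * B ^ (1 - f.natDegree * ε) := by
  have hf : f ≠ 0 := by rintro rfl; simp at hn
  have hν : 0 < f.natDegree * ε := mul_pos (by exact_mod_cast hn) hε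
  have ha : 0 < |(f.leadingCoeff : ℝ)| := by simpa using hf
  -- For bounds up to constants, any `c` and `c'` on the two sides of the critical value will do;
  -- half and twice the leading coefficient are used.
  obtain ⟨c, hc, hca⟩ := exists_pos_pow_inv_eq hn (half_pos ha)
  obtain ⟨c', hc', hca'⟩ := exists_pos_pow_inv_eq hn (mul_pos two_pos ha)
  obtain ⟨E, hE, h⟩ := exists_countN_le hε hn hnε hnd hl hw hc (by linarith)
  obtain ⟨E', hE', h'⟩ := exists_le_countN hε hn hnε hnd hl hw hc' (by linarith)
  set ν := f.natDegree * ε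
  -- Half of the lower main term `2 * c' ^ ν * ψ` is given up to absorb the error.
  refine ⟨c' ^ ν * ψ, 2 * c ^ ν * A + 1, by positivity, ?_⟩
  filter_upwards [h, h', (tendsto_mul_log_div_atTop hν hc).eventually hH,
    (tendsto_mul_log_div_atTop hν hc').eventually hH, hE.def one_pos,
    hE'.def (show 0 < c' ^ ν * ψ by positivity), eventually_gt_atTop 0] with B h1 h2 h3 h4 h5 h6 hB
  have hBθ : 0 < B ^ (1 - ν) := Real.rpow_pos_of_pos hB _
  rw [Real.norm_of_nonneg hBθ.le, Real.norm_eq_abs] at h5 h6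
  have h7 := le_abs_self (E B)
  have h8 := le_abs_self (E' B)
  constructor
  · have : 2 * c' ^ ν * B ^ (1 - ν) * ψ ≤ 2 * c' ^ ν * B ^ (1 - ν) *
        primeSum (residueWeight f) (profile ν⁻¹) l (ν * Real.log (B / c')) := by
      gcongr; exact h4.1
    linarith
  · have : 2 * c ^ ν * B ^ (1 - ν) *
        primeSum (residueWeight f) (profile ν⁻¹) l (ν * Real.log (B / c)) ≤
        2 * c ^ ν * B ^ (1 - ν) * A := by
      gcongr; exact h3.2
    linarith

end

/-! ### Failure of an exact asymptotic for a single root prime -/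

/-- Counting in symmetric windows: translation away from the origin. -/
theorem ncard_add_ncard_eq_two_mul {A : Set ℤ} {B : ℝ} {L : ℤ} (hB : 0 < B) (hL : 0 ≤ L)
    (h : ∀ x : ℤ, B < |(x : ℝ)| → |(x : ℝ)| ≤ B + L →
      ((if 0 < x then x + L else x - L) ∈ A ↔ x ∈ A)) :
    {x : ℤ | |(x : ℝ)| ≤ B + 2 * L ∧ x ∈ A}.ncard + {x : ℤ | |(x : ℝ)| ≤ B ∧ x ∈ A}.ncard =
      2 * {x : ℤ | |(x : ℝ)| ≤ B + L ∧ x ∈ A}.ncard := by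
  have hLR : (0 : ℝ) ≤ L := by exact_mod_cast hL
  set A₁ : Set ℤ := {x : ℤ | (B < |(x : ℝ)| ∧ |(x : ℝ)| ≤ B + L) ∧ x ∈ A}
  set A₂ : Set ℤ := {x : ℤ | (B + L < |(x : ℝ)| ∧ |(x : ℝ)| ≤ B + 2 * L) ∧ x ∈ A}
  have hfin : ∀ R : ℝ, {x : ℤ | |(x : ℝ)| ≤ R ∧ x ∈ A}.Finite := fun R => by
    refine (Set.finite_Icc (-⌊R⌋) ⌊R⌋).subset fun x hx => ?_
    have h : |x| ≤ ⌊R⌋ := by rw [Int.le_floor]; push_cast; exact hx.1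
    exact abs_le.1 h
  have hA₁ : A₁.Finite := (hfin (B + L)).subset fun x hx => ⟨hx.1.2, hx.2⟩
  have hA₂ : A₂.Finite := (hfin (B + 2 * L)).subset fun x hx => ⟨hx.1.2, hx.2⟩
  have hpos : ∀ x : ℤ, 0 < x → |(x : ℝ)| = x := fun x hx => abs_of_pos (by exact_mod_cast hx)
  have hneg : ∀ x : ℤ, ¬ 0 < x → |(x : ℝ)| = -x := fun x hx =>
    abs_of_nonpos (by exact_mod_cast not_lt.1 hx)
  have himg : A₂ = (fun x : ℤ => if 0 < x then x + L else x - L) '' A₁ := by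
    ext y
    constructor
    · rintro ⟨⟨h1, h2⟩, hy⟩
      by_cases hy0 : 0 < y
      · rw [hpos y hy0] at h1 h2
        have hx0 : 0 < y - L := by
          have : (0 : ℝ) < ((y - L : ℤ) : ℝ) := by push_cast; linarith
          exact_mod_cast this
        have hx : B < |((y - L : ℤ) : ℝ)| ∧ |((y - L : ℤ) : ℝ)| ≤ B + L := by
          rw [hpos _ hx0]; push_cast; constructor <;> linarith
        refine ⟨y - L, ⟨hx, (h _ hx.1 hx.2).1 ?_⟩, ?_⟩
        · rwa [if_pos hx0, sub_add_cancel]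
        · simp only [if_pos hx0, sub_add_cancel]
      · rw [hneg y hy0] at h1 h2
        have hx0 : y + L < 0 := by
          have : ((y + L : ℤ) : ℝ) < 0 := by push_cast; linarith
          exact_mod_cast this
        have hx : B < |((y + L : ℤ) : ℝ)| ∧ |((y + L : ℤ) : ℝ)| ≤ B + L := by
          rw [hneg _ hx0.le.not_gt]; push_cast; constructor <;> linarith
        refine ⟨y + L, ⟨hx, (h _ hx.1 hx.2).1 ?_⟩, ?_⟩
        · rwa [if_neg hx0.le.not_gt, add_sub_cancel_right]
        · simp only [if_neg hx0.le.not_gt, add_sub_cancel_right]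
    · rintro ⟨x, ⟨⟨h1, h2⟩, hx⟩, rfl⟩
      refine ⟨?_, (h x h1 h2).2 hx⟩
      by_cases hx0 : 0 < x
      · rw [hpos x hx0] at h1 h2
        simp only [hx0, if_true]
        rw [hpos _ (by omega)]; push_cast; constructor <;> linarith
      · rw [hneg x hx0] at h1 h2
        simp only [hx0, if_false]
        rw [hneg _ (by omega)]; push_cast; constructor <;> linarith
  have hcard : A₂.ncard = A₁.ncard := by
    rw [himg]
    refine Set.InjOn.ncard_image fun x hx y hy hxy => ?_
    split_ifs at hxy <;> omega
  have h1 : {x : ℤ | |(x : ℝ)| ≤ B + L ∧ x ∈ A} = {x : ℤ | |(x : ℝ)| ≤ B ∧ x ∈ A} ∪ A₁ := by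
    ext x
    simp only [A₁, Set.mem_union, Set.mem_ofPred_eq]
    constructor
    · rintro ⟨ha, hb⟩
      rcases le_or_gt |(x : ℝ)| B with hc | hc
      exacts [Or.inl ⟨hc, hb⟩, Or.inr ⟨⟨hc, ha⟩, hb⟩]
    · rintro (⟨ha, hb⟩ | ⟨⟨-, ha⟩, hb⟩)
      exacts [⟨by linarith, hb⟩, ⟨ha, hb⟩]
  have h2 : {x : ℤ | |(x : ℝ)| ≤ B + 2 * L ∧ x ∈ A} =
      {x : ℤ | |(x : ℝ)| ≤ B + L ∧ x ∈ A} ∪ A₂ := by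
    ext x
    simp only [A₂, Set.mem_union, Set.mem_ofPred_eq]
    constructor
    · rintro ⟨ha, hb⟩
      rcases le_or_gt |(x : ℝ)| (B + L) with hc | hc
      exacts [Or.inl ⟨hc, hb⟩, Or.inr ⟨⟨hc, ha⟩, hb⟩]
    · rintro (⟨ha, hb⟩ | ⟨⟨-, ha⟩, hb⟩)
      exacts [⟨by linarith, hb⟩, ⟨ha, hb⟩]
  have h3 := Set.ncard_union_eq (s := {x : ℤ | |(x : ℝ)| ≤ B ∧ x ∈ A}) (t := A₁)
    (Set.disjoint_left.2 fun x hx hx' => absurd hx.1 (not_le.2 hx'.1.1)) (hfin B) hA₁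
  have h4 := Set.ncard_union_eq (s := {x : ℤ | |(x : ℝ)| ≤ B + L ∧ x ∈ A}) (t := A₂)
    (Set.disjoint_left.2 fun x hx hx' => absurd hx.1 (not_le.2 hx'.1.1)) (hfin (B + L)) hA₂
  rw [h2, h4, hcard, h1, h3]
  ring

section

variable {f : ℤ[X]} {S : Finset Nat.Primes} {p : Nat.Primes} {E : ℕ}

/-- A common multiple of the parts of the `f(x)` composed of the primes in `S` other than `p`. -/
def cofactorBound (S : Finset Nat.Primes) (p : Nat.Primes) (E : ℕ) : ℕ :=
  ∏ q ∈ S.erase p, (q : ℕ) ^ E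

theorem cofactorBound_pos (S : Finset Nat.Primes) (p : Nat.Primes) (E : ℕ) :
    0 < cofactorBound S p E := Finset.prod_pos fun q _ => pow_pos q.2.pos _

theorem sPart_eq_mul_erase (hp : p ∈ S) (y : ℤ) :
    sPart S y = (p : ℕ) ^ padicValInt (p : ℕ) y * sPart (S.erase p) y :=
  (Finset.mul_prod_erase S (fun q : Nat.Primes => (q : ℕ) ^ padicValInt (q : ℕ) y) hp).symm

theorem sPart_pos (S : Finset Nat.Primes) (y : ℤ) : 0 < sPart S y :=
  Finset.prod_pos fun q _ => pow_pos q.2.pos _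

/-- The gap in the values of the `S`-part. If `v_p(y) ≥ j`, the value is a multiple of `p ^ j` and
the next one is at least one step larger; if `v_p(y) ≤ j`, it is at most `p ^ j` times
`cofactorBound S p E`. -/
theorem succ_mul_le_sPart (hp : p ∈ S) {y : ℤ}
    (hE : ∀ q ∈ S.erase p, padicValInt (q : ℕ) y < E) {j : ℕ}
    (h : (p : ℕ) ^ j * cofactorBound S p E < sPart S y) :
    (p : ℕ) ^ j * (cofactorBound S p E + 1) ≤ sPart S y := by
  rw [sPart_eq_mul_erase hp] at h ⊢
  set k := padicValInt (p : ℕ) y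
  set P := cofactorBound S p E
  have hv : sPart (S.erase p) y ≤ P :=
    Nat.le_of_dvd (cofactorBound_pos S p E) (Finset.prod_dvd_prod_of_dvd _ _ fun q hq =>
      pow_dvd_pow _ (hE q hq).le)
  rcases le_total j k with hjk | hjk
  · obtain ⟨i, hi⟩ := Nat.exists_eq_add_of_le hjk
    rw [hi, pow_add, mul_assoc] at h ⊢
    exact Nat.mul_le_mul_left _ (Nat.lt_of_mul_lt_mul_left h)
  · exact absurd h (not_lt.2 (Nat.mul_le_mul (Nat.pow_le_pow_right p.2.pos hjk) hv))

theorem padicValInt_eq_of_modEq {q e : ℕ} [Fact q.Prime] {m : ℤ} (hm : (q : ℤ) ^ e ∣ m) {x y : ℤ}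
    (hxy : x ≡ y [ZMOD m]) (hx : f.eval x ≠ 0) (he : padicValInt q (f.eval x) < e) :
    padicValInt q (f.eval y) = padicValInt q (f.eval x) := by
  have h := padicValInt_eq_iff.1 ⟨hx, (rfl : padicValInt q (f.eval x) = _)⟩
  refine (padicValInt_eq_iff.2 ⟨?_, fun h' => h.2 ?_⟩).2
  · exact (dvd_eval_iff_of_modEq f ((pow_dvd_pow _ he.le).trans hm) hxy).1 h.1
  · exact (dvd_eval_iff_of_modEq f ((pow_dvd_pow _ he).trans hm) hxy).2 h'

/-- With `P = cofactorBound S p E`, the residue class determines all valuations unless `v_p ≥ j +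
P`. In that case the inequality is automatic, because `p ^ P > P`. -/
theorem mul_lt_sPart_of_modEq (hp : p ∈ S)
    (hE : ∀ x, f.eval x ≠ 0 → ∀ q ∈ S.erase p, padicValInt (q : ℕ) (f.eval x) < E) {j : ℕ} {x y : ℤ}
    (hxy : x ≡ y [ZMOD
      (cofactorBound S p E * (p : ℕ) ^ (j + cofactorBound S p E) : ℕ)])
    (hx : f.eval x ≠ 0) (hy : f.eval y ≠ 0)
    (h : (p : ℕ) ^ j * cofactorBound S p E < sPart S (f.eval x)) :
    (p : ℕ) ^ j * cofactorBound S p E < sPart S (f.eval y) := by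
  set P := cofactorBound S p E with hP
  have hdvdp : ((p : ℕ) : ℤ) ^ (j + P) ∣ ((P * (p : ℕ) ^ (j + P) : ℕ) : ℤ) := by
    push_cast; exact dvd_mul_left _ _
  by_cases hv : padicValInt (p : ℕ) (f.eval x) < j + P
  · have h1 : sPart S (f.eval y) = sPart S (f.eval x) := by
      refine Finset.prod_congr rfl fun q hq => ?_
      by_cases hqp : q = p
      · subst hqp
        rw [padicValInt_eq_of_modEq hdvdp hxy hx hv]
      · have hqS : q ∈ S.erase p := Finset.mem_erase.2 ⟨hqp, hq⟩
        have hdvd : ((q : ℕ) : ℤ) ^ E ∣ ((P * (p : ℕ) ^ (j + P) : ℕ) : ℤ) := by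
          have : (q : ℕ) ^ E ∣ P :=
            Finset.dvd_prod_of_mem (fun q : Nat.Primes => (q : ℕ) ^ E) hqS
          exact_mod_cast this.mul_right _
        rw [padicValInt_eq_of_modEq hdvd hxy hx (hE x hx q hqS)]
    rwa [h1]
  · have h1 : ((p : ℕ) : ℤ) ^ (j + P) ∣ f.eval x := by
      rw [padicValInt_dvd_iff]; exact Or.inr (not_lt.1 hv)
    rw [dvd_eval_iff_of_modEq f hdvdp hxy, padicValInt_dvd_iff] at h1
    have h2 := h1.resolve_left hy
    rw [sPart_eq_mul_erase hp]
    calc (p : ℕ) ^ j * P < (p : ℕ) ^ j * (p : ℕ) ^ P :=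
          Nat.mul_lt_mul_of_pos_left (Nat.lt_pow_self p.2.one_lt) (pow_pos p.2.pos _)
      _ = (p : ℕ) ^ (j + P) := (pow_add _ _ _).symm
      _ ≤ (p : ℕ) ^ padicValInt (p : ℕ) (f.eval y) := Nat.pow_le_pow_right p.2.pos h2
      _ ≤ _ := Nat.le_mul_of_pos_right _ (sPart_pos _ _)

/-- On suitable geometric windows the counted integers are those of a periodic set. -/
theorem exists_window {ε : ℝ} (hε : 0 < ε) (hn : 1 ≤ f.natDegree) (hp : p ∈ S)
    (hE : ∀ x, f.eval x ≠ 0 → ∀ q ∈ S.erase p, padicValInt (q : ℕ) (f.eval x) < E) :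
    ∃ b₀ b₁ : ℝ, 0 < b₀ ∧ b₀ < b₁ ∧ ∀ᶠ j : ℕ in atTop, ∀ x : ℤ,
      b₀ * (((p : ℕ) : ℝ) ^ (f.natDegree * ε)⁻¹) ^ j < |(x : ℝ)| →
      |(x : ℝ)| ≤ b₁ * (((p : ℕ) : ℝ) ^ (f.natDegree * ε)⁻¹) ^ j →
      f.eval x ≠ 0 ∧ ((0 < |((f.eval x : ℤ) : ℝ)| ^ ε ∧
        |((f.eval x : ℤ) : ℝ)| ^ ε ≤ (sPart S (f.eval x) : ℝ)) ↔
        (p : ℕ) ^ j * cofactorBound S p E < sPart S (f.eval x)) := by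
  have hf : f ≠ 0 := by rintro rfl; simp at hn
  have hν : 0 < f.natDegree * ε := mul_pos (by exact_mod_cast hn) hε
  set κ := (f.natDegree * ε)⁻¹
  have hκ : 0 < κ := inv_pos.2 hν
  set P := cofactorBound S p E
  have hP : (0 : ℝ) < P := by exact_mod_cast cofactorBound_pos S p E
  have hp1 : (1 : ℝ) < (p : ℕ) := by exact_mod_cast p.2.one_lt
  have hp0 : (0 : ℝ) < (p : ℕ) := zero_lt_one.trans hp1
  have ha : 0 < |(f.leadingCoeff : ℝ)| := by simpa using hf
  obtain ⟨c₀, hc₀, hca⟩ := exists_pos_pow_inv_eq hn ha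
  have hPκ : 0 < (P : ℝ) ^ κ := by positivity
  have hPκ' : 0 < ((P : ℝ) + 1) ^ κ := by positivity
  -- Constants `c > c₀ > c'` are taken so close to the critical `c₀` that `c P^κ < c' (P+1)^κ`. The
  -- window between these values, scaled by `p^(jκ)`, forces `p^j P < |f(x)|^ε ≤ p^j (P+1)`.
  have hlt : c₀ * (P : ℝ) ^ κ < c₀ * ((P : ℝ) + 1) ^ κ := by gcongr; linarith
  obtain ⟨m, hm1, hm2⟩ := exists_between hlt
  obtain ⟨c, hc1, hc2⟩ := exists_between ((lt_div_iff₀ hPκ).2 hm1)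
  obtain ⟨c', hc1', hc2'⟩ := exists_between ((div_lt_iff₀ hPκ').2 hm2)
  rw [lt_div_iff₀ hPκ] at hc2
  rw [div_lt_iff₀ hPκ'] at hc1'
  have hc : 0 < c := hc₀.trans hc1
  have hc' : 0 < c' := by
    by_contra! h
    nlinarith [mul_pos hc₀ hPκ]
  obtain ⟨x₁, h₁⟩ := exists_abs_le_of_abs_eval_rpow_le hf hε hn hc (by
    rw [← hca]
    exact inv_strictAnti₀ (by positivity) (pow_lt_pow_left₀ hc1 hc₀.le (by omega)))
  obtain ⟨x₂, h₂⟩ := exists_abs_eval_rpow_le_of_abs_le hf hε hn hc' (by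
    rw [← hca]
    exact inv_strictAnti₀ (by positivity) (pow_lt_pow_left₀ hc2' hc'.le (by omega)))
  obtain ⟨x₃, h₃⟩ := exists_eval_ne_zero_of_le_abs hf
  have hlam : 1 < ((p : ℕ) : ℝ) ^ κ := Real.one_lt_rpow hp1 hκ
  have htend : Tendsto (fun j : ℕ => c * (P : ℝ) ^ κ * (((p : ℕ) : ℝ) ^ κ) ^ j) atTop atTop :=
    (tendsto_pow_atTop_atTop_of_one_lt hlam).const_mul_atTop (by positivity)
  refine ⟨c * (P : ℝ) ^ κ, c' * ((P : ℝ) + 1) ^ κ, by positivity, hc2.trans hc1', ?_⟩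
  filter_upwards [htend.eventually_ge_atTop (max x₁ (max x₂ x₃))] with j hj x hx1 hx2
  have hx : max x₁ (max x₂ x₃) ≤ |(x : ℝ)| := hj.trans hx1.le
  rw [max_le_iff, max_le_iff] at hx
  have hpow : ∀ y : ℝ, 0 ≤ y → (((p : ℕ) : ℝ) ^ j * y) ^ κ = y ^ κ * (((p : ℕ) : ℝ) ^ κ) ^ j := by
    intro y hy
    rw [Real.mul_rpow (by positivity) hy, mul_comm, ← Real.rpow_natCast, ← Real.rpow_natCast,
      ← Real.rpow_mul hp0.le, ← Real.rpow_mul hp0.le, mul_comm (j : ℝ)]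
  have hfx := h₃ x hx.2.2
  have hlow : ((p : ℕ) : ℝ) ^ j * P < |((f.eval x : ℤ) : ℝ)| ^ ε := by
    by_contra! h
    have := h₁ x hx.1 _ h
    rw [hpow _ hP.le, ← mul_assoc] at this
    linarith
  have hup : |((f.eval x : ℤ) : ℝ)| ^ ε ≤ ((p : ℕ) : ℝ) ^ j * (P + 1) := by
    refine h₂ x hx.2.1 _ (by positivity) ?_
    rw [hpow _ (by positivity), ← mul_assoc]
    exact hx2
  refine ⟨hfx, ⟨fun h => ?_, fun h => ⟨Real.rpow_pos_of_pos (abs_pos.2 (by exact_mod_cast hfx)) _,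
    hup.trans ?_⟩⟩⟩
  · exact_mod_cast hlow.trans_le h.2
  · exact_mod_cast succ_mul_le_sPart hp (hE x hfx) h

theorem tendsto_div_rpow_of_tendsto {N : ℝ → ℝ} {C θ x : ℝ} {X Λ : ℕ → ℝ} (hx : 0 < x)
    (hN : Tendsto (fun B => N B / B ^ θ) atTop (𝓝 C)) (hΛ : Tendsto Λ atTop atTop)
    (hX : Tendsto (fun j => X j / Λ j) atTop (𝓝 x)) :
    Tendsto (fun j => N (X j) / Λ j ^ θ) atTop (𝓝 (C * x ^ θ)) := by
  have hXtop : Tendsto X atTop atTop := by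
    refine (hX.pos_mul_atTop hx hΛ).congr' ?_
    filter_upwards [hΛ.eventually_gt_atTop 0] with j hj
    field_simp
  refine ((hN.comp hXtop).mul (hX.rpow_const (p := θ) (Or.inl hx.ne'))).congr' ?_
  filter_upwards [hΛ.eventually_gt_atTop 0, hXtop.eventually_gt_atTop 0] with j h1 h2
  have h3 := (Real.rpow_pos_of_pos h2 θ).ne'
  rw [Function.comp, Real.div_rpow h2.le h1.le]
  field_simp

/-- On the windows the counts at three equally spaced points satisfy an exact midpoint relation.
After rescaling, a limit `C` would give `C ((b+2ℓ)^(1-ν) + b^(1-ν) - 2 (b+ℓ)^(1-ν)) = 0`, which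
strict concavity excludes for `C ≠ 0`. -/
theorem not_tendsto_countN_div {ε : ℝ} (hε : 0 < ε) (hn : 1 ≤ f.natDegree)
    (hnε : f.natDegree * ε < 1) (hp : p ∈ S)
    (hE : ∀ x, f.eval x ≠ 0 → ∀ q ∈ S.erase p, padicValInt (q : ℕ) (f.eval x) < E) {C : ℝ}
    (hC : C ≠ 0) :
    ¬ Tendsto (fun B : ℝ => (countN f S ε B : ℝ) / B ^ (1 - f.natDegree * ε)) atTop (𝓝 C) := by
  intro hlim
  have hν : 0 < f.natDegree * ε := mul_pos (by exact_mod_cast hn) hε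
  obtain ⟨b₀, b₁, hb₀, hb₁, hwin⟩ := exists_window hε hn hp hE
  set ν := f.natDegree * ε
  set P := cofactorBound S p E
  have hp1 : (1 : ℝ) < (p : ℕ) := by exact_mod_cast p.2.one_lt
  have hp0 : (0 : ℝ) < (p : ℕ) := zero_lt_one.trans hp1
  set lam := ((p : ℕ) : ℝ) ^ ν⁻¹
  have hplam : ((p : ℕ) : ℝ) < lam := by
    have := Real.rpow_lt_rpow_of_exponent_lt hp1 ((one_lt_inv₀ hν).2 hnε)
    rwa [Real.rpow_one] at this
  have hlam1 : 1 < lam := hp1.trans hplam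
  have hlam0 : 0 < lam := zero_lt_one.trans hlam1
  -- A quarter of the window keeps `b`, `b + ℓ` and `b + 2ℓ` strictly inside `(b₀, b₁)`.
  set ℓ := (b₁ - b₀) / 4
  have hℓ : 0 < ℓ := by simp only [ℓ]; linarith
  set b := b₀ + ℓ
  have hb2 : b + 2 * ℓ < b₁ := by simp only [b, ℓ]; linarith
  have hb : 0 < b := by positivity
  set m : ℕ → ℕ := fun j => P * (p : ℕ) ^ (j + P)
  have hm0 : ∀ j, 0 < m j := fun j => Nat.mul_pos (cofactorBound_pos S p E) (pow_pos p.2.pos _)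
  -- The largest multiple of the period `m j` not exceeding `ℓ * lam ^ j`. Since `ν < 1` gives `p <
  -- lam`, the period is negligible and `L j / lam ^ j` tends to `ℓ`.
  set L : ℕ → ℕ := fun j => m j * ⌊ℓ * lam ^ j / m j⌋₊
  have hLle : ∀ j, (L j : ℝ) ≤ ℓ * lam ^ j := by
    intro j
    have hmj : (0 : ℝ) < m j := by exact_mod_cast hm0 j
    have h := Nat.floor_le (show 0 ≤ ℓ * lam ^ j / m j by positivity)
    rw [le_div_iff₀' hmj] at h
    simpa [L] using h
  have hLge : ∀ j, ℓ * lam ^ j - m j ≤ (L j : ℝ) := by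
    intro j
    have hmj : (0 : ℝ) < m j := by exact_mod_cast hm0 j
    have h := Nat.lt_floor_add_one (ℓ * lam ^ j / m j)
    rw [div_lt_iff₀' hmj] at h
    simp only [L]
    push_cast
    linarith
  have hΛ : Tendsto (fun j : ℕ => lam ^ j) atTop atTop := tendsto_pow_atTop_atTop_of_one_lt hlam1
  have hLlim : Tendsto (fun j => (L j : ℝ) / lam ^ j) atTop (𝓝 ℓ) := by
    have h1 : Tendsto (fun j : ℕ => ℓ - P * ((p : ℕ) : ℝ) ^ P * (((p : ℕ) : ℝ) / lam) ^ j) atTop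
        (𝓝 (ℓ - P * ((p : ℕ) : ℝ) ^ P * 0)) :=
      tendsto_const_nhds.sub ((tendsto_pow_atTop_nhds_zero_of_lt_one (by positivity)
        ((div_lt_one hlam0).2 hplam)).const_mul _)
    rw [mul_zero, sub_zero] at h1
    refine tendsto_of_tendsto_of_tendsto_of_le_of_le h1 tendsto_const_nhds (fun j => ?_)
      fun j => ?_
    · have h2 := hLge j
      have h3 : (m j : ℝ) = P * ((p : ℕ) : ℝ) ^ P * ((p : ℕ) : ℝ) ^ j := by
        simp only [m]; push_cast; rw [pow_add]; ring
      rw [h3] at h2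
      change _ ≤ (L j : ℝ) / lam ^ j
      rw [le_div_iff₀ (by positivity), sub_mul, div_pow, mul_assoc (P * ((p : ℕ) : ℝ) ^ P),
        div_mul_cancel₀ _ (by positivity)]
      exact h2
    · change (L j : ℝ) / lam ^ j ≤ ℓ
      rw [div_le_iff₀ (by positivity)]
      exact hLle j
  have hX : ∀ i : ℝ, Tendsto (fun j => (b * lam ^ j + i * L j) / lam ^ j) atTop (𝓝 (b + i * ℓ)) := by
    intro i
    refine (tendsto_const_nhds.add (hLlim.const_mul i)).congr fun j => ?_
    have : lam ^ j ≠ 0 := by positivity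
    field_simp
  have hkey : ∀ᶠ j : ℕ in atTop,
      countN f S ε (b * lam ^ j + 2 * L j) + countN f S ε (b * lam ^ j + 0 * L j) =
        2 * countN f S ε (b * lam ^ j + 1 * L j) := by
    filter_upwards [hwin] with j hj
    have hlj : 0 < lam ^ j := by positivity
    have hBpos : 0 < b * lam ^ j := by positivity
    have h := ncard_add_ncard_eq_two_mul (L := (L j : ℤ))
      (A := {x : ℤ | 0 < |((f.eval x : ℤ) : ℝ)| ^ ε ∧
        |((f.eval x : ℤ) : ℝ)| ^ ε ≤ (sPart S (f.eval x) : ℝ)}) hBpos (Int.natCast_nonneg _) ?_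
    · simpa [countN] using h
    · intro x hx1 hx2
      rw [Int.cast_natCast] at hx2
      have hL := hLle j
      have hb0b : b₀ * lam ^ j ≤ b * lam ^ j := by
        gcongr; simp only [b]; linarith
      have hend : b * lam ^ j + 2 * L j ≤ b₁ * lam ^ j := by
        have : (b + 2 * ℓ) * lam ^ j ≤ b₁ * lam ^ j := by gcongr
        linarith
      have hL0 : (0 : ℝ) ≤ L j := Nat.cast_nonneg _
      obtain ⟨hfx, hiff⟩ := hj x (by linarith) (by linarith)
      set y := if 0 < x then x + (L j : ℤ) else x - L j with hy
      have hyabs : |(y : ℝ)| = |(x : ℝ)| + L j := by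
        by_cases hx0 : 0 < x
        · have : (0 : ℝ) < x := by exact_mod_cast hx0
          rw [hy, if_pos hx0]
          push_cast
          rw [abs_of_pos this, abs_of_nonneg (by linarith)]
        · have : (x : ℝ) ≤ 0 := by exact_mod_cast not_lt.1 hx0
          rw [hy, if_neg hx0]
          push_cast
          rw [abs_of_nonpos this, abs_of_nonpos (by linarith)]
          ring
      obtain ⟨hfy, hiffy⟩ := hj y (by linarith) (by linarith)
      have hdvd : (m j : ℤ) ∣ L j := by exact_mod_cast dvd_mul_right (m j) _
      have hxy : x ≡ y [ZMOD (m j : ℕ)] := by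
        rw [Int.modEq_iff_dvd]
        by_cases hx0 : 0 < x
        · rw [hy, if_pos hx0]; simpa using hdvd
        · rw [hy, if_neg hx0]; simpa using hdvd
      rw [Set.mem_ofPred_eq, Set.mem_ofPred_eq, hiff, hiffy]
      exact ⟨mul_lt_sPart_of_modEq hp hE hxy.symm hfy hfx, mul_lt_sPart_of_modEq hp hE hxy hfx hfy⟩
  have hlimi : ∀ i : ℝ, 0 ≤ i → Tendsto (fun j => (countN f S ε (b * lam ^ j + i * L j) : ℝ) /
      (lam ^ j) ^ (1 - ν)) atTop (𝓝 (C * (b + i * ℓ) ^ (1 - ν))) := fun i hi =>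
    tendsto_div_rpow_of_tendsto (N := fun B => (countN f S ε B : ℝ)) (by positivity) hlim hΛ (hX i)
  have heq := tendsto_nhds_unique (((hlimi 2 (by norm_num)).add (hlimi 0 le_rfl)).congr' (by
    filter_upwards [hkey] with j hj
    rw [← add_div]
    have : (countN f S ε (b * lam ^ j + 2 * L j) : ℝ) + countN f S ε (b * lam ^ j + 0 * L j) =
      2 * countN f S ε (b * lam ^ j + 1 * L j) := by exact_mod_cast hj
    rw [this, mul_div_assoc])) ((hlimi 1 zero_le_one).const_mul 2)
  have hconc := (Real.strictConcaveOn_rpow (p := 1 - ν) (by linarith) (by linarith)).2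
    (show b + 2 * ℓ ∈ Set.Ici 0 from Set.mem_Ici.2 (by positivity))
    (show b ∈ Set.Ici 0 from hb.le) (by linarith) (show (0 : ℝ) < 1 / 2 by norm_num)
    (show (0 : ℝ) < 1 / 2 by norm_num) (by norm_num)
  have hmid : (1 / 2 : ℝ) • (b + 2 * ℓ) + (1 / 2 : ℝ) • b = b + 1 * ℓ := by
    simp only [smul_eq_mul]; ring
  rw [hmid] at hconc
  simp only [smul_eq_mul, zero_mul, add_zero] at hconc heq
  have : C * ((b + 2 * ℓ) ^ (1 - ν) + b ^ (1 - ν) - 2 * (b + 1 * ℓ) ^ (1 - ν)) = 0 := by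
    linear_combination heq
  rcases mul_eq_zero.1 this with h | h
  · exact hC h
  · linarith

end

end

/-! ### Conclusion -/

theorem mainTheorem1 (f : ℤ[X]) (n : ℕ) (hn : 1 ≤ n) (hf : f.natDegree = n)
    (ε : ℝ) (hε : 0 < ε) (hε' : ε < 1 / (n : ℝ)) (S : Finset Nat.Primes)
    (hroots : ∀ p ∈ rootPrimes f S, ∀ α : ℤ_[(p : ℕ)], (toPadic f p).rootMultiplicity α ≤ 1) :
    (2 ≤ (rootPrimes f S).card →
      ∃ C : ℝ, 0 < C ∧
        (fun B : ℝ => (countN f S ε B : ℝ)) ~[atTop]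
          fun B : ℝ => C * B ^ (1 - n * ε) * Real.log B ^ ((rootPrimes f S).card - 1)) ∧
    ((rootPrimes f S).card = 1 →
      ((fun B : ℝ => (countN f S ε B : ℝ)) =Θ[atTop] fun B : ℝ => B ^ (1 - n * ε)) ∧
      (liminf (fun B : ℝ => (countN f S ε B : ℝ) / B ^ (1 - n * ε)) atTop <
        limsup (fun B : ℝ => (countN f S ε B : ℝ) / B ^ (1 - n * ε)) atTop) ∧
      ¬ ∃ C : ℝ, (fun B : ℝ => (countN f S ε B : ℝ)) ~[atTop]
          fun B : ℝ => C * B ^ (1 - n * ε)) := by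
  classical
  subst hf
  have hf0 : f ≠ 0 := by rintro rfl; simp at hn
  have hn0 : (0 : ℝ) < f.natDegree := by exact_mod_cast hn
  have hν : 0 < f.natDegree * ε := mul_pos hn0 hε
  have hnε : f.natDegree * ε < 1 := by rwa [lt_div_iff₀' hn0] at hε'
  have hκ : 1 < (f.natDegree * ε)⁻¹ := (one_lt_inv₀ hν).2 hnε
  have hex : ∀ p : Nat.Primes, ∃ c : ℝ, p ∈ S → IsWeight (residueWeight f p) c ∧
      (0 < c ↔ ∃ α : ℤ_[(p : ℕ)], (toPadic f p).IsRoot α) := by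
    intro p
    by_cases hp : p ∈ S
    · obtain ⟨c, hc⟩ := exists_isWeight_residueWeight f hf0 p (by
        -- For primes of `S` without a root the multiplicity condition is vacuous, so the weights
        -- are controlled at every prime of `S`.
        by_cases hroot : ∃ α : ℤ_[(p : ℕ)], (toPadic f p).IsRoot α
        · exact hroots p (Finset.mem_filter.2 ⟨hp, hroot⟩)
        · intro α
          rw [rootMultiplicity_eq_zero fun h => hroot ⟨α, h⟩]
          exact zero_le_one)
      exact ⟨c, fun _ => hc⟩
    · exact ⟨0, fun h => absurd h hp⟩
  choose c hc using hex
  have hw : ∀ p ∈ S, IsWeight (residueWeight f p) (c p) := fun p hp => (hc p hp).1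
  have hS' : S.filter (0 < c ·) = rootPrimes f S := by
    ext p
    rw [rootPrimes, Finset.mem_filter, Finset.mem_filter]
    exact and_congr_right fun hp => (hc p hp).2
  refine ⟨fun h2 => ?_, fun h1 => ?_⟩
  · obtain ⟨l, hnd, hl, C, hC, hlim⟩ := exists_list_tendsto_primeSum hκ S hw (by rwa [hS'])
    rw [hS'] at hlim
    exact countN_isEquivalent hε hn hnε hnd hl (fun p hp => hw p (by rw [← hl]; simpa using hp))
      hC hlim
  · obtain ⟨l, hnd, hl, ψ, A, hψ, hbd⟩ := exists_list_bounds_primeSum hκ S hw (by rwa [hS'])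
    obtain ⟨k, K, hk, hN⟩ := exists_bounds_countN hε hn hnε hnd hl
      (fun p hp => hw p (by rw [← hl]; simpa using hp)) hψ hbd
    obtain ⟨p, hp⟩ := Finset.card_eq_one.1 h1
    have hpS : p ∈ S := by
      have : p ∈ rootPrimes f S := by simp [hp]
      exact (Finset.mem_filter.1 this).1
    obtain ⟨E, hE⟩ : ∃ E, ∀ x, f.eval x ≠ 0 → ∀ q ∈ S.erase p,
        padicValInt (q : ℕ) (f.eval x) < E := by
      have hzero : ∀ q : Nat.Primes, ∃ E : ℕ, q ∈ S.erase p → ∀ e, E ≤ e → residueWeight f q e = 0 := by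
        intro q
        by_cases hq : q ∈ S.erase p
        · have hqS := Finset.mem_of_mem_erase hq
          have hcq : c q = 0 := by
            obtain ⟨E, hE⟩ := (hw q hqS).eventually_eq
            refine le_antisymm (not_lt.1 fun h => Finset.ne_of_mem_erase hq ?_)
              (hE E le_rfl ▸ (hw q hqS).nonneg E)
            have : q ∈ rootPrimes f S := hS' ▸ Finset.mem_filter.2 ⟨hqS, h⟩
            simpa [hp] using this
          obtain ⟨E, hE⟩ := (hw q hqS).eventually_eq
          exact ⟨E, fun _ e he => (hE e he).trans hcq⟩
        · exact ⟨0, fun h => absurd h hq⟩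
      choose E hE using hzero
      -- A vanishing weight means that no residue class attains the exponent, so it bounds the
      -- valuations of all nonzero values of `f`; the sum serves all the primes at once.
      refine ⟨∑ q ∈ S.erase p, E q, fun x hx q hq => ?_⟩
      refine lt_of_lt_of_le ?_ (Finset.single_le_sum (f := E) (fun _ _ => Nat.zero_le _) hq)
      by_contra! h
      have h0 := hE q hq _ h
      have hq0 : ((q : ℕ) : ℝ) ≠ 0 := by exact_mod_cast q.2.ne_zero
      rw [residueWeight, div_eq_zero_iff, or_iff_left hq0, Nat.cast_eq_zero,
        Finset.card_eq_zero] at h0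
      have h3 := padicValInt_eq_iff.1 ⟨hx, (rfl : padicValInt (q : ℕ) (f.eval x) = _)⟩
      have h4 := mod_mem_exactResidues q.2.pos h3.1 h3.2
      rw [h0] at h4
      exact absurd h4 (Finset.notMem_empty _)
    have hdiv : ∀ᶠ B : ℝ in atTop, k ≤ (countN f S ε B : ℝ) / B ^ (1 - f.natDegree * ε) ∧
        (countN f S ε B : ℝ) / B ^ (1 - f.natDegree * ε) ≤ K := by
      filter_upwards [hN, eventually_gt_atTop 0] with B hB hB0
      have hBθ : 0 < B ^ (1 - f.natDegree * ε) := Real.rpow_pos_of_pos hB0 _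
      rw [le_div_iff₀ hBθ, div_le_iff₀ hBθ]
      exact hB
    have hle : IsBoundedUnder (· ≤ ·) atTop
        fun B : ℝ => (countN f S ε B : ℝ) / B ^ (1 - f.natDegree * ε) :=
      isBoundedUnder_of_eventually_le (hdiv.mono fun _ h => h.2)
    have hge : IsBoundedUnder (· ≥ ·) atTop
        fun B : ℝ => (countN f S ε B : ℝ) / B ^ (1 - f.natDegree * ε) :=
      isBoundedUnder_of_eventually_ge (hdiv.mono fun _ h => h.1)
    have hno : ∀ C : ℝ, ¬ Tendsto (fun B : ℝ => (countN f S ε B : ℝ) / B ^ (1 - f.natDegree * ε))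
        atTop (𝓝 C) := by
      intro C hlim
      -- The lower bound excludes the limit zero, the one value that the concavity argument cannot.
      have hC : 0 < C := hk.trans_le (ge_of_tendsto hlim (hdiv.mono fun _ h => h.1))
      exact not_tendsto_countN_div hε hn hnε hpS hE hC.ne' hlim
    refine ⟨⟨IsBigO.of_bound K ?_, IsBigO.of_bound k⁻¹ ?_⟩, ?_, ?_⟩
    · filter_upwards [hN, eventually_gt_atTop 0] with B hB hB0
      rw [Real.norm_of_nonneg (Nat.cast_nonneg _), Real.norm_of_nonneg (by positivity)]
      exact hB.2
    · filter_upwards [hN, eventually_gt_atTop 0] with B hB hB0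
      rw [Real.norm_of_nonneg (Nat.cast_nonneg _), Real.norm_of_nonneg (by positivity),
        le_inv_mul_iff₀ hk]
      exact hB.1
    · by_contra! h
      exact hno _ (tendsto_of_le_liminf_of_limsup_le le_rfl h hle hge)
    · rintro ⟨C, hC⟩
      refine hno C ?_
      have h2 := (hC.div (IsEquivalent.refl (u := fun B : ℝ => B ^ (1 - f.natDegree * ε)))).congr_right
        (v := _) (w := fun _ => C) (by
          filter_upwards [eventually_gt_atTop 0] with B hB0
          have hBθ : 0 < B ^ (1 - f.natDegree * ε) := Real.rpow_pos_of_pos hB0 _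
          rw [Pi.div_apply, mul_div_cancel_right₀ _ hBθ.ne'])
      exact h2.symm.tendsto_nhds tendsto_const_nhds
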